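/- Let $T$ be a $(d_1,d_2)$-biregular tree with $d_1,d_2\ge 3$, let $VT$ be its vertex set and $d$ its graph distance. Let $\operatorname{Aut}(T)$ be the group of the automorphisms $g$ of $T$ such that $d(gv,v)$ is even for every $v\in VT$, with the topology of pointwise convergence. Let $\Gamma\le\operatorname{Aut}(T)$ be a tree lattice, that is, a discrete subgroup such that $\operatorname{Aut}(T)/\Gamma$ admits an $\operatorname{Aut}(T)$-invariant Borel probability measure. Let $Q=\Gamma\backslash T$ be the quotient graph, with vertex set $VQ$, and let $\pi:VT\to VQ$ be the projection. For $v\in VT$ and $n\ge 0$ let $\rho^v_n$ be the uniform distribution on the sphere $\{w\in VT: d(v,w)=n\}$. Fix $o\in VT$, and for $v\in VT$ put $\epsilon(v)=0$ if $d(o,v)$ is even and $\epsilon(v)=1$ if it is odd. 1. (Non-escape of mass) For every $v\in VT$ and $\varepsilon>0$ there is a finite set $K\subset VQ$ such that $\pi_*\rho^v_n(K)\ge 1-\varepsilon$ for all $n\ge 0$. 2. (Limiting distribution) There are an integer $p\ge 1$ and probability distributions $\mu_j$ ($j\in\mathbb Z/p\mathbb Z$) on $VQ$ such that for all $v\in VT$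 and all $0\le j<p$ $$\pi_*\rho^v_{pn+j}\longrightarrow \mu_{j+\epsilon(v)}\qquad (n\to\infty).$$ 3. (Exponential convergence) If, in addition, $\Gamma$ is geometrically finite, then one can take $p=2$ in 2, and for the corresponding $\mu_0,\mu_1$ there is $r>1$ such that for all $v\in VT$ and $j\in\{0,1\}$ $$\|\pi_*\rho^v_{2n+j}-\mu_{j+\epsilon(v)}\|=o(r^{-n})\qquad (n\to\infty),$$ where $\|\cdot\|$ is the total variation norm. Here a directed edge $e$ of $Q$ with a lift $\tilde e$, whose initial vertex is $\tilde v$, has the index $\operatorname{ind}(e)=[\Gamma_{\tilde v}:\Gamma_{\tilde e}]$, and $\Gamma$ is called geometrically finite if $Q$ contains a non-empty finite subgraph $F$ whose set-theoretic complement is a disjoint union of finitely many open Nagao rays. An open Nagao ray is an infinite ray $x_0,x_1,x_2,\dots$ without its origin $x_0$ (here $x_0\in F$), such that for all $i\ge1$ the edge from $x_i$ to $x_{i+1}$ has index $1$ and the edge from $x_i$ to $x_{i-1}$ has index $\deg(x_i)-1$, where $\deg(x_i)$ is the valency in $T$ of the lifts of $x_i$. -/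

import Mathlib

open MeasureTheory Filter Topology Asymptotics

noncomputable section

namespace TreeLattice

variable {V : Type*} {T : SimpleGraph V}

/-- `T` is `(d₁, d₂)`-biregular: there is a proper 2-colouring of the vertices for which the
vertices of the first colour have valency `d₁` and those of the second colour valency `d₂`. -/
def IsBiregular (T : SimpleGraph V) (d₁ d₂ : ℕ) : Prop :=
  ∃ c : T.Coloring Bool, ∀ v : V,
    (T.neighborSet v).encard = if c v = true then (d₁ : ℕ∞) else (d₂ : ℕ∞)

/-! ### The group of automorphisms without inversion, with the topology of pointwise convergence -/

theorem even_dist_iff (hT : T.IsTree) (c : T.Coloring (Fin 2)) (u v : V) :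
    Even (T.dist u v) ↔ c u = c v := by
  let e : Fin 2 ≃ Bool := finTwoEquiv
  let c' : T.Coloring Bool := SimpleGraph.Coloring.mk (fun v => e (c v))
    (fun h h' => c.valid h (e.injective h'))
  obtain ⟨p, hp⟩ := hT.connected.exists_walk_length_eq_dist u v
  rw [← hp, c'.even_length_iff_congr p]
  change (e (c u) = true ↔ e (c v) = true) ↔ _
  rw [← e.injective.eq_iff (a := c u)]
  exact Bool.eq_iff_iff.symm

theorem even_dist_trans (hT : T.IsTree) {u v w : V} (h₁ : Even (T.dist u v))
    (h₂ : Even (T.dist v w)) : Even (T.dist u w) := by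
  let c := hT.coloringTwo
  rw [even_dist_iff hT c] at *
  exact h₁.trans h₂

/-- `Aut(T)`: the group of the automorphisms `g` of the tree `T` such that the distance from
`v` to `g v` is even for every vertex `v`. -/
def treeAut (T : SimpleGraph V) (hT : T.IsTree) : Subgroup (T ≃g T) where
  carrier := {g | ∀ v : V, Even (T.dist (g v) v)}
  mul_mem' := fun {g h} hg hh v => even_dist_trans hT (hg (h v)) (hh v)
  one_mem' := fun v => by
    change Even (T.dist v v)
    simp
  inv_mem' := fun {g} hg v => by
    have h := hg (g⁻¹ v)
    have h' : g (g⁻¹ v) = v := RelIso.apply_inv_self g v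
    rw [h', SimpleGraph.dist_comm] at h
    exact h

/-- The topology of pointwise convergence, `V` being discrete. -/
instance autTopology : TopologicalSpace (T ≃g T) :=
  TopologicalSpace.induced (fun (g : T ≃g T) (v : V) => g v)
    (@Pi.topologicalSpace V (fun _ => V) (fun _ => ⊥))

variable {hT : T.IsTree}

/-- `Γ` is a tree lattice: a discrete subgroup of `G = Aut(T)` such that `G ⧸ Γ` carries a
`G`-invariant Borel probability measure. -/
def IsTreeLattice (Γ : Subgroup (treeAut T hT)) : Prop :=
  DiscreteTopology Γ ∧
    ∃ m : @Measure (treeAut T hT ⧸ Γ) (borel _), @IsProbabilityMeasure _ (borel _) m ∧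
      ∀ g : treeAut T hT,
        @Measure.map _ _ (borel _) (borel _) (fun x : treeAut T hT ⧸ Γ => g • x) m = m

/-! ### The quotient edge-indexed graph -/

/-- Automorphisms act on the directed edges of `T`. -/
instance dartAction : MulAction (T ≃g T) T.Dart where
  smul g d := ⟨(g d.fst, g d.snd), g.map_rel_iff.2 d.adj⟩
  one_smul _ := rfl
  mul_smul _ _ _ := rfl

/-- The vertices of `Q = Γ \ T`. -/
def VQ (Γ : Subgroup (treeAut T hT)) : Type _ := MulAction.orbitRel.Quotient Γ V

/-- The directed edges of `Q = Γ \ T`. -/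
def EQ (Γ : Subgroup (treeAut T hT)) : Type _ := MulAction.orbitRel.Quotient Γ T.Dart

/-- `VQ` is a discrete space: every subset is measurable. -/
instance (Γ : Subgroup (treeAut T hT)) : MeasurableSpace (VQ Γ) := ⊤

/-- The projection `π : VT → VQ`. -/
def proj (Γ : Subgroup (treeAut T hT)) (v : V) : VQ Γ :=
  Quotient.mk (MulAction.orbitRel Γ V) v

/-- The projection `ET → EQ`. -/
def projE (Γ : Subgroup (treeAut T hT)) (d : T.Dart) : EQ Γ :=
  Quotient.mk (MulAction.orbitRel Γ T.Dart) d

/-- The initial vertex of an edge of `Q`. -/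
def init {Γ : Subgroup (treeAut T hT)} : EQ Γ → VQ Γ :=
  Quotient.lift (fun d : T.Dart => proj Γ d.fst) (by
    rintro _ b ⟨g, rfl⟩
    exact Quotient.sound ⟨g, rfl⟩)

/-- The edge of `Q` with the opposite direction. -/
def rev {Γ : Subgroup (treeAut T hT)} : EQ Γ → EQ Γ :=
  Quotient.lift (fun d : T.Dart => projE Γ d.symm) (by
    rintro _ b ⟨g, rfl⟩
    exact Quotient.sound ⟨g, rfl⟩)

/-- The terminal vertex of an edge of `Q`. -/
def term {Γ : Subgroup (treeAut T hT)} : EQ Γ → VQ Γ :=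
  Quotient.lift (fun d : T.Dart => proj Γ d.snd) (by
    rintro _ b ⟨g, rfl⟩
    exact Quotient.sound ⟨g, rfl⟩)

/-- The index `[Γ_{∂₀ d} : Γ_d]` of a directed edge `d` of `T`. -/
def liftInd (Γ : Subgroup (treeAut T hT)) (d : T.Dart) : ℕ :=
  (MulAction.stabilizer Γ d).relIndex (MulAction.stabilizer Γ d.fst)

theorem liftInd_smul (Γ : Subgroup (treeAut T hT)) (g : Γ) (d : T.Dart) :
    liftInd Γ (g • d) = liftInd Γ d := by
  have h : (g • d).fst = g • d.fst := rfl
  unfold liftInd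
  rw [h, MulAction.stabilizer_smul_eq_stabilizer_map_conj,
    MulAction.stabilizer_smul_eq_stabilizer_map_conj]
  exact Subgroup.relIndex_map_map_of_injective _ _ (MulAut.conj g).injective

/-- The index of an edge of `Q`: that of any of its lifts. -/
def ind {Γ : Subgroup (treeAut T hT)} : EQ Γ → ℕ :=
  Quotient.lift (liftInd Γ) (by
    rintro _ b ⟨g, rfl⟩
    exact liftInd_smul Γ g b)

/-- The degree of a vertex of `Q`: the valency in `T` of any of its lifts. -/
def deg {Γ : Subgroup (treeAut T hT)} : VQ Γ → ℕ :=
  Quotient.lift (fun v : V => (T.neighborSet v).ncard) (by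
    rintro _ b ⟨g, rfl⟩
    have h : T.neighborSet (g • b) = (g : treeAut T hT).1 '' T.neighborSet b := by
      ext w
      constructor
      · intro hw
        refine ⟨(g : treeAut T hT).1.symm w, ?_, RelIso.apply_symm_apply _ _⟩
        rw [SimpleGraph.mem_neighborSet] at hw ⊢
        rw [← (g : treeAut T hT).1.map_rel_iff, RelIso.apply_symm_apply]
        exact hw
      · rintro ⟨x, hx, rfl⟩
        exact (g : treeAut T hT).1.map_rel_iff.2 hx
    change (T.neighborSet (g • b)).ncard = _
    rw [h]
    exact Set.ncard_image_of_injective _ (g : treeAut T hT).1.injective)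

/-- `(Q, ind)` is geometrically finite: there is a finite subgraph, with vertices `F` and edges
`F'`, whose complement in `Q` is a disjoint union of finitely many open Nagao rays.
The `k`-th ray has the consecutive edges `r k 0, r k 1, …`, directed towards infinity; its origin
`init (r k 0)` lies in `F`, and the remaining vertices `term (r k i)` make up the open ray. All
edges towards infinity except the first one have index `1`, and the opposite edges have as index
the degree of their initial vertex minus one. -/
def IsGeometricallyFinite (Γ : Subgroup (treeAut T hT)) : Prop :=
  ∃ (F : Set (VQ Γ)) (F' : Set (EQ Γ)) (m : ℕ) (r : Fin m → ℕ → EQ Γ),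
    F.Finite ∧ F.Nonempty ∧ F'.Finite ∧
    (∀ e ∈ F', init e ∈ F ∧ term e ∈ F ∧ rev e ∈ F') ∧
    (∀ k, init (r k 0) ∈ F) ∧
    (∀ k i, init (r k (i + 1)) = term (r k i)) ∧
    Function.Injective (fun x : Fin m × ℕ => term (r x.1 x.2)) ∧
    (∀ v, v ∉ F ↔ ∃ k i, v = term (r k i)) ∧
    (∀ e, e ∉ F' ↔ ∃ k i, e = r k i ∨ e = rev (r k i)) ∧
    (∀ k i, ind (r k (i + 1)) = 1) ∧
    (∀ k i, ind (rev (r k i)) + 1 = deg (term (r k i)))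

/-! ### Spheres -/

/-- The uniform distribution `ρ_n` on the sphere `S(v, n)` of `T`. -/
def sphereUniform (T : SimpleGraph V) (v : V) (n : ℕ) : @Measure V ⊤ :=
  @ProbabilityTheory.uniformOn V ⊤ {w : V | T.dist v w = n}

/-- The projection `π_* ρ_n` to `VQ` of the uniform distribution on the sphere `S(v, n)`. -/
def sphereProj (Γ : Subgroup (treeAut T hT)) (v : V) (n : ℕ) : Measure (VQ Γ) :=
  @Measure.map V (VQ Γ) ⊤ _ (proj Γ) (sphereUniform T v n)

instance sphereProj_finite (Γ : Subgroup (treeAut T hT)) (v : V) (n : ℕ) :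
    IsFiniteMeasure (sphereProj Γ v n) := by
  let _ : MeasurableSpace V := ⊤
  unfold sphereProj sphereUniform
  infer_instance

/-- The total variation norm `‖μ - ν‖`. -/
def tvNorm {X : Type*} [MeasurableSpace X] (μ ν : Measure X) [IsFiniteMeasure μ]
    [IsFiniteMeasure ν] : ℝ :=
  ((μ.toSignedMeasure - ν.toSignedMeasure).totalVariation Set.univ).toReal

/-- The probability distributions `μ_j`, `j ∈ ℤ/p`, on `VQ` are the limits of the projected
spheres along the residue classes modulo `p`: for all vertices `v` at even distance from the
base vertex `o` one has `π_* ρ_{pn+j} → μ_j`, and for all those at odd distance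
`π_* ρ_{pn+j} → μ_{j+1}`. (Convergence in the discrete space `VQ`: on every subset.) -/
def SpheresConverge (Γ : Subgroup (treeAut T hT)) (o : V) (p : ℕ)
    (μ : ZMod p → ProbabilityMeasure (VQ Γ)) : Prop :=
  ∀ v : V, ∀ j < p, ∀ A : Set (VQ Γ),
    Tendsto (fun n : ℕ => (sphereProj Γ v (p * n + j)).real A) atTop
      (𝓝 ((μ ((j + T.dist o v % 2 : ℕ) : ZMod p) : Measure (VQ Γ)).real A))

end TreeLattice

end

/-! A vertex of the sphere of radius `n + 1` about `v` is the end of a non-backtracking walk of `n`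
steps that starts along an edge out of `v`. Since valencies depend only on the colour, uniform
choices at each step give the uniform distribution (`sphereProj_real`). The theorem thus concerns
iterates of the averaging operator `step` on bounded `Γ`-invariant functions `f` of directed edges.

The invariant probability measure on `Aut(T) ⧸ Γ` assigns to `f` the average `mean m f`. As `Aut(T)`
is transitive on the directed edges whose origin has a given colour (`exists_treeAut_dart`), this
average takes only two values on edges, and `step` exchanges them (`mean_step`). By Jensen, the
second moment of the iterates, summed over both orientations of an edge, decreases; so the mean
variance over the continuations of an edge tends to `0`. Each `Γ`-orbit of edges has positive mass
(`mean_orbitInd_pos`), so the variance tends to `0` at every single edge (`tendsto_step_sub`).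
Valency at least `3` makes it possible to turn around, and connectedness then shows that the
iterates are asymptotically equal on all edges with origin of one colour. They are therefore
asymptotic to their mean, which alternates with period `2`. This gives the limits with `p = 2`;
since the limits are probability measures on a countable set, no mass escapes.

In the geometrically finite case a Lyapunov function growing along the Nagao rays (`exists_drift`)
and a minorization deduced from the convergence just proved (`exists_minorization`) feed a Harris
type contraction (`harris_contraction`). Its rate is uniform over all `f` bounded by `1`, hence
holds in total variation. -/

namespace TreeLattice

/-! ### Automorphisms of a biregular tree -/

section Geometry

variable {V : Type*} {T : SimpleGraph V}

theorem even_dist_iff_bool (hT : T.IsTree) (c : T.Coloring Bool) (u v : V) :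
    Even (T.dist u v) ↔ c u = c v := by
  obtain ⟨p, hp⟩ := hT.connected.exists_walk_length_eq_dist u v
  rw [← hp, c.even_length_iff_congr p]
  exact Bool.eq_iff_iff.symm

theorem color_eq_not {c : T.Coloring Bool} {u v : V} (h : T.Adj u v) : c v = !c u := by
  have := c.valid h
  cases hu : c u <;> cases hv : c v <;> simp_all

theorem exists_adj_dist_add_one (hT : T.IsTree) {v w : V} (h : v ≠ w) :
    ∃ b, T.Adj v b ∧ T.dist b w + 1 = T.dist v w := by
  obtain ⟨p, hp⟩ := hT.connected.exists_walk_length_eq_dist v w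
  cases p with
  | nil => exact absurd rfl h
  | @cons _ b _ hb q =>
    refine ⟨b, hb, ?_⟩
    have h1 := T.dist_le q
    rw [SimpleGraph.Walk.length_cons] at hp
    have h2 := hT.dist_eq_dist_add_one_of_adj w hb
    rw [T.dist_comm (u := w) (v := v), T.dist_comm (u := w) (v := b)] at h2
    omega

theorem adj_dist_unique (hT : T.IsTree) {v w b b' : V} (hb : T.Adj v b) (hb' : T.Adj v b')
    (h : T.dist b w + 1 = T.dist v w) (h' : T.dist b' w + 1 = T.dist v w) : b = b' := by
  obtain ⟨p, hp⟩ := hT.connected.exists_walk_length_eq_dist b w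
  obtain ⟨p', hp'⟩ := hT.connected.exists_walk_length_eq_dist b' w
  have h1 : (SimpleGraph.Walk.cons hb p).IsPath :=
    SimpleGraph.Walk.isPath_of_length_eq_dist _ (by rw [SimpleGraph.Walk.length_cons, hp, h])
  have h2 : (SimpleGraph.Walk.cons hb' p').IsPath :=
    SimpleGraph.Walk.isPath_of_length_eq_dist _ (by rw [SimpleGraph.Walk.length_cons, hp', h'])
  have := (hT.isAcyclic.subsingleton_path v w).elim ⟨_, h1⟩ ⟨_, h2⟩
  have h3 : (SimpleGraph.Walk.cons hb p) = (SimpleGraph.Walk.cons hb' p') := congrArg Subtype.val this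
  injection h3

theorem adj_dist_cases (hT : T.IsTree) {v b : V} (w : V) (hb : T.Adj v b) :
    T.dist b w = T.dist v w + 1 ∨ T.dist b w + 1 = T.dist v w := by
  have h2 := hT.dist_eq_dist_add_one_of_adj w hb
  rw [T.dist_comm (u := w) (v := v), T.dist_comm (u := w) (v := b)] at h2
  omega

/-- Any bijection of the two stars is corrected by a transposition. The hypotheses stand behind the
existential so that `choose` yields one total function. -/
theorem exists_bijOn_neighborSet [T.LocallyFinite] (b a b' a' : V) :
    ∃ s : V → V, T.Adj b a → T.Adj b' a' → T.degree b = T.degree b' →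
      Set.BijOn s (T.neighborSet b) (T.neighborSet b') ∧ s a = a' := by
  classical
  by_cases h : T.Adj b a ∧ T.Adj b' a' ∧ T.degree b = T.degree b'
  · obtain ⟨h1, h2, h3⟩ := h
    have hc : Fintype.card (T.neighborSet b) = Fintype.card (T.neighborSet b') := by
      rw [SimpleGraph.card_neighborSet_eq_degree, SimpleGraph.card_neighborSet_eq_degree, h3]
    let e := Fintype.equivOfCardEq hc
    let e' := e.trans (Equiv.swap (e ⟨a, h1⟩) ⟨a', h2⟩)
    refine ⟨fun v => if h : T.Adj b v then (e' ⟨v, h⟩).1 else v, fun _ _ _ => ⟨⟨?_, ?_, ?_⟩, ?_⟩⟩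
    · intro v hv
      have hv' : T.Adj b v := hv
      simp only [hv', dif_pos]
      exact (e' ⟨v, hv⟩).2
    · intro v hv w hw hvw
      have hv' : T.Adj b v := hv
      have hw' : T.Adj b w := hw
      simp only [hv', hw', dif_pos] at hvw
      have := e'.injective (Subtype.ext hvw)
      exact congrArg Subtype.val this
    · intro w hw
      refine ⟨(e'.symm ⟨w, hw⟩).1, (e'.symm ⟨w, hw⟩).2, ?_⟩
      have hv' : T.Adj b (e'.symm ⟨w, hw⟩).1 := (e'.symm ⟨w, hw⟩).2
      change (if h : T.Adj b (e'.symm ⟨w, hw⟩).1 then (e' ⟨_, h⟩).1 else _) = w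
      rw [dif_pos hv']
      exact congrArg Subtype.val (e'.apply_symm_apply ⟨w, hw⟩)
    · simp only [h1, dif_pos]
      simp [e']
  · exact ⟨id, fun h1 h2 h3 => absurd ⟨h1, h2, h3⟩ h⟩

open Classical in
/-- The neighbour of `v` on the geodesic to `u`. -/
noncomputable def parent (hT : T.IsTree) (u v : V) : V :=
  if h : v = u then u else (exists_adj_dist_add_one hT h).choose

theorem parent_adj (hT : T.IsTree) {u v : V} (h : v ≠ u) : T.Adj v (parent hT u v) := by
  unfold parent
  rw [dif_neg h]
  exact (exists_adj_dist_add_one hT h).choose_spec.1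

theorem parent_dist (hT : T.IsTree) {u v : V} (h : v ≠ u) :
    T.dist (parent hT u v) u + 1 = T.dist v u := by
  unfold parent
  rw [dif_neg h]
  exact (exists_adj_dist_add_one hT h).choose_spec.2

theorem parent_eq (hT : T.IsTree) {u v p : V} (h : T.Adj v p)
    (hd : T.dist p u + 1 = T.dist v u) : parent hT u v = p := by
  have hne : v ≠ u := by
    rintro rfl
    simp at hd
  exact adj_dist_unique hT (parent_adj hT hne) h (parent_dist hT hne) hd

open Classical in
/-- The extension to `T` of the assignment `u ↦ u'`, `y ↦ y'` along the local maps `σ`,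
together with the image of the previous vertex on the geodesic to `u`. -/
noncomputable def extendAux (hT : T.IsTree) (σ : V → V → V → V → V → V) (u y u' y' : V)
    (v : V) : V × V :=
  if _h : v = u then (u', y') else
    let p := parent hT u v
    let q := extendAux hT σ u y u' y' p
    (σ p (if p = u then y else parent hT u p) q.1 q.2 v, q.1)
termination_by T.dist v u
decreasing_by
  have := parent_dist hT _h
  omega

/-- `Aut(T)` acts transitively on the directed edges with initial vertex of a given colour. -/
theorem exists_treeAut_dart (hT : T.IsTree) [T.LocallyFinite] (c : T.Coloring Bool)
    (hdeg : ∀ v w, c v = c w → T.degree v = T.degree w) {u y u' y' : V} (h : T.Adj u y)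
    (h' : T.Adj u' y') (hc : c u = c u') :
    ∃ g : treeAut T hT, g.1 u = u' ∧ g.1 y = y' := by
  classical
  choose σ hσ using fun b a b' a' => exists_bijOn_neighborSet (T := T) b a b' a'
  set ψ := extendAux hT σ u y u' y' with hψ
  -- The marked neighbour of `v`, whose image is prescribed when the star of `v` is mapped. The root
  -- has no parent; there `y` takes its place, which forces `y` to go to `y'`.
  let pr : V → V := fun v => if v = u then y else parent hT u v
  have ψ_root : ψ u = (u', y') := by rw [hψ, extendAux]; simp
  have ψ_ne : ∀ v, v ≠ u → ψ v = (σ (parent hT u v) (pr (parent hT u v)) (ψ (parent hT u v)).1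
      (ψ (parent hT u v)).2 v, (ψ (parent hT u v)).1) := by
    intro v hv
    conv_lhs => rw [hψ, extendAux]
    rw [dif_neg hv]
  have pr_adj : ∀ v, T.Adj v (pr v) := by
    intro v
    by_cases hv : v = u
    · simp only [pr, hv, if_true]; exact h
    · simp only [pr, hv, if_false]; exact parent_adj hT hv
  -- The local maps behave well only for adjacent pairs and equal valencies, so adjacency and colour
  -- are carried along together.
  have key : ∀ n v, T.dist v u = n → T.Adj (ψ v).1 (ψ v).2 ∧ c (ψ v).1 = c v := by
    intro n
    induction n with
    | zero =>
      intro v hv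
      have : v = u := hT.connected.dist_eq_zero_iff.1 hv
      subst this
      rw [ψ_root]
      exact ⟨h', hc.symm⟩
    | succ n ih =>
      intro v hv
      have hne : v ≠ u := by rintro rfl; simp at hv
      have hp := parent_dist hT hne
      obtain ⟨i1, i2⟩ := ih (parent hT u v) (by omega)
      have hs := (hσ (parent hT u v) (pr (parent hT u v)) (ψ (parent hT u v)).1
        (ψ (parent hT u v)).2 (pr_adj _) i1 (hdeg _ _ i2.symm)).1
      have hm := hs.mapsTo (parent_adj hT hne).symm
      rw [ψ_ne v hne]
      have hm' : T.Adj (ψ (parent hT u v)).1 (σ (parent hT u v) (pr (parent hT u v))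
        (ψ (parent hT u v)).1 (ψ (parent hT u v)).2 v) := hm
      refine ⟨hm'.symm, ?_⟩
      rw [color_eq_not hm', i2, color_eq_not (parent_adj hT hne).symm]
  have key1 : ∀ v, T.Adj (ψ v).1 (ψ v).2 := fun v => (key _ v rfl).1
  have key2 : ∀ v, c (ψ v).1 = c v := fun v => (key _ v rfl).2
  let φ : V → V := fun v => (ψ v).1
  have hloc : ∀ v, Set.BijOn (σ v (pr v) (ψ v).1 (ψ v).2) (T.neighborSet v) (T.neighborSet (φ v))
      ∧ σ v (pr v) (ψ v).1 (ψ v).2 (pr v) = (ψ v).2 := fun v =>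
    hσ v (pr v) (ψ v).1 (ψ v).2 (pr_adj v) (key1 v) (hdeg _ _ (key2 v).symm)
  have φ_child : ∀ v w, T.Adj v w → T.dist w u = T.dist v u + 1 →
      φ w = σ v (pr v) (ψ v).1 (ψ v).2 w := by
    intro v w hvw hd
    have hne : w ≠ u := by rintro rfl; simp at hd
    have := parent_eq hT hvw.symm hd.symm
    simp only [φ]
    rw [ψ_ne w hne, this]
  have φ_y : φ y = y' := by
    rw [φ_child u y h (by simp [h.symm])]
    have := (hloc u).2
    simpa [pr, ψ_root] using this
  have φ_pr : ∀ v, φ (pr v) = (ψ v).2 := by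
    intro v
    by_cases hv : v = u
    · simp only [pr, hv, if_true, ψ_root, φ_y]
    · simp only [pr, hv, if_false]
      rw [ψ_ne v hv]
  -- A map that is bijective on every star is a covering, and a covering of a tree by a tree is an
  -- isomorphism; the rest proves this by hand.
  have φ_loc : ∀ v, Set.BijOn φ (T.neighborSet v) (T.neighborSet (φ v)) := by
    intro v
    refine (hloc v).1.congr ?_
    intro w hw
    have hw' : T.Adj v w := hw
    rcases adj_dist_cases hT u hw' with hd | hd
    · exact (φ_child v w hw' hd).symm
    · have hne : v ≠ u := by rintro rfl; simp at hd
      have h1 : pr v = w := by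
        simp only [pr, hne, if_false]
        exact parent_eq hT hw' hd
      rw [← h1, φ_pr, (hloc v).2]
  have φ_u : φ u = u' := by simp only [φ, ψ_root]
  have φ_adj : ∀ {v w}, T.Adj v w → T.Adj (φ v) (φ w) := fun {v w} hvw => (φ_loc v).mapsTo hvw
  have φ_dist : ∀ n v, T.dist v u = n → T.dist (φ v) u' = n := by
    intro n
    induction n using Nat.strong_induction_on with
    | _ n ih =>
      intro v hv
      rcases n with _ | n
      · have : v = u := hT.connected.dist_eq_zero_iff.1 hv
        subst this
        simp [φ_u]
      · have hne : v ≠ u := by rintro rfl; simp at hv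
        have hp := parent_dist hT hne
        have hpa := parent_adj hT hne
        set p := parent hT u v
        have hp' := ih n (by omega) p (by omega)
        rcases adj_dist_cases hT u' (φ_adj hpa.symm) with hd | hd
        · omega
        -- If `φ v` were closer to `u'` than `φ p`, it would coincide with the image of the parent
        -- of `p`, against injectivity on the star of `p`.
        · exfalso
          have hpne : p ≠ u := by
            intro hpu
            rw [hpu, φ_u] at hd
            simp at hd
          have hq := parent_dist hT hpne
          have hqa := parent_adj hT hpne
          have hq' := ih (n - 1) (by omega) (parent hT u p) (by omega)
          have := adj_dist_unique hT (φ_adj hpa.symm) (φ_adj hqa) hd (by omega)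
          have := (φ_loc p).injOn hpa.symm hqa this
          rw [← this] at hq
          omega
  have φ_inj : ∀ n v w, T.dist v u = n → φ v = φ w → v = w := by
    intro n
    induction n with
    | zero =>
      intro v w hv hvw
      have h1 := φ_dist _ v hv
      rw [hvw] at h1
      have h2 := φ_dist _ w rfl
      rw [hT.connected.dist_eq_zero_iff.1 hv, hT.connected.dist_eq_zero_iff.1 (h2.symm.trans h1)]
    | succ n ih =>
      intro v w hv hvw
      have h1 := φ_dist _ v hv
      have h2 := φ_dist _ w rfl
      rw [← hvw, h1] at h2
      have hv0 : v ≠ u := by rintro rfl; simp at hv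
      have hw0 : w ≠ u := by rintro rfl; simp at h2
      have pv := parent_dist hT hv0
      have pw := parent_dist hT hw0
      have av := parent_adj hT hv0
      have aw := parent_adj hT hw0
      have e1 := φ_dist _ _ (rfl : T.dist (parent hT u v) u = _)
      have e2 := φ_dist _ _ (rfl : T.dist (parent hT u w) u = _)
      have a2 := φ_adj aw
      rw [← hvw] at a2
      have hpp := ih (parent hT u v) (parent hT u w) (by omega)
        (adj_dist_unique hT (φ_adj av) a2 (by rw [e1]; omega) (by rw [e2]; omega))
      have aw' := aw.symm
      rw [← hpp] at aw'
      exact (φ_loc (parent hT u v)).injOn av.symm aw' hvw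
  have φ_injective : Function.Injective φ := fun v w hvw => φ_inj _ v w rfl hvw
  have φ_surjective : Function.Surjective φ := by
    -- Walks ending in the image lift backwards edge by edge, by surjectivity on stars.
    have aux : ∀ {w z : V} (_ : T.Walk w z), (∃ v, φ v = z) → ∃ v, φ v = w := by
      intro w z p hz
      induction p with
      | nil => exact hz
      | cons hab p ih =>
      obtain ⟨v, hv⟩ := ih hz
      rw [← hv] at hab
      obtain ⟨x, _, hx⟩ := (φ_loc v).surjOn hab.symm
      exact ⟨x, hx⟩
    intro w
    obtain ⟨p⟩ := hT.connected.preconnected w u'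
    exact aux p ⟨u, φ_u⟩
  let g : T ≃g T :=
    { toEquiv := Equiv.ofBijective φ ⟨φ_injective, φ_surjective⟩
      map_rel_iff' := by
        intro v w
        refine ⟨fun hvw => ?_, fun hvw => φ_adj hvw⟩
        obtain ⟨x, hx, hxw⟩ := (φ_loc v).surjOn (show φ w ∈ T.neighborSet (φ v) from hvw)
        rwa [← φ_injective hxw] }
  refine ⟨⟨g, fun v => ?_⟩, φ_u, φ_y⟩
  rw [even_dist_iff_bool hT c]
  exact key2 v

theorem color_smul {hT : T.IsTree} (c : T.Coloring Bool) (g : treeAut T hT) (v : V) :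
    c (g.1 v) = c v :=
  (even_dist_iff_bool hT c _ _).1 (g.2 v)

end Geometry

/-! ### Spheres and the non-backtracking walk -/

section Spheres

open scoped BigOperators

variable {V : Type*} {T : SimpleGraph V} [DecidableEq V] [T.LocallyFinite]

variable (T) in
/-- One step of the non-backtracking walk: the average of `f` over the directed edges
that continue `(x, y)` without backtracking. -/
noncomputable def step (f : V → V → ℝ) (x y : V) : ℝ :=
  𝔼 b ∈ (T.neighborFinset y).erase x, f y b

theorem mem_succ {x y b : V} : b ∈ (T.neighborFinset y).erase x ↔ b ≠ x ∧ T.Adj y b := by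
  simp

theorem card_succ {x y : V} (h : T.Adj x y) :
    ((T.neighborFinset y).erase x).card = T.degree y - 1 := by
  rw [Finset.card_erase_of_mem (by simpa using h.symm)]
  rfl

theorem succ_nonempty {x y : V} (hd : 3 ≤ T.degree y) :
    ((T.neighborFinset y).erase x).Nonempty := by
  rw [← Finset.card_pos]
  have := Finset.pred_card_le_card_erase (s := T.neighborFinset y) (a := x)
  rw [SimpleGraph.card_neighborFinset_eq_degree] at this
  omega

omit [DecidableEq V] in
theorem finite_sphere (hT : T.IsTree) (n : ℕ) (v : V) : {w | T.dist v w = n}.Finite := by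
  induction n generalizing v with
  | zero =>
    refine (Set.finite_singleton v).subset fun w hw => ?_
    exact (hT.connected.dist_eq_zero_iff.1 hw).symm
  | succ n ih =>
    refine ((T.neighborFinset v).finite_toSet.biUnion fun b _ => ih b).subset fun w hw => ?_
    have hw' : T.dist v w = n + 1 := hw
    obtain ⟨b, hb, hd⟩ := exists_adj_dist_add_one hT (v := v) (w := w)
      (by rintro rfl; simp at hw')
    simp only [Set.mem_iUnion]
    exact ⟨b, by simpa using hb, by simp; omega⟩

omit [DecidableEq V] in
theorem countable_of_locallyFinite (hT : T.IsTree) : Countable V := by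
  obtain ⟨o⟩ := hT.connected.nonempty
  rw [← Set.countable_univ_iff]
  refine (Set.countable_iUnion fun n => (finite_sphere hT n o).countable).mono fun w _ => ?_
  simp

/-- The sum over the vertices at distance `n` from `y` and `n + 1` from `x`. -/
theorem finsum_forward (hT : T.IsTree) (c : T.Coloring Bool) (d : Bool → ℕ)
    (hd : ∀ v, T.degree v = d (c v)) (hd3 : ∀ i, 3 ≤ d i) (n : ℕ) :
    ∃ K : Bool → ℝ, (∀ i, 0 < K i) ∧ ∀ (F : V → ℝ) (x y : V), T.Adj x y →
      ∑ᶠ w ∈ {w | T.dist y w = n ∧ T.dist x w = n + 1}, F w =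
        K (c y) * (step T)^[n] (fun _ z => F z) x y := by
  induction n with
  | zero =>
    refine ⟨fun _ => 1, fun _ => one_pos, fun F x y hxy => ?_⟩
    have : {w | T.dist y w = 0 ∧ T.dist x w = 0 + 1} = {y} := by
      ext w
      simp only [Set.mem_ofPred_eq, Set.mem_singleton_iff]
      constructor
      · rintro ⟨h, _⟩
        exact (hT.connected.dist_eq_zero_iff.1 h).symm
      · rintro rfl
        simpa using hxy
    rw [this, finsum_mem_singleton]
    simp
  | succ n ih =>
    obtain ⟨K, hK, hF⟩ := ih
    -- Beyond `y` there are `d (c y) - 1` branches, whose first vertices all have the other colour;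
    -- so the normalization depends on the colour of `y` alone.
    refine ⟨fun i => (d i - 1 : ℕ) * K (!i), fun i => ?_, fun F x y hxy => ?_⟩
    · have := hd3 i
      exact mul_pos (by exact_mod_cast (by omega)) (hK _)
    have hset : {w | T.dist y w = n + 1 ∧ T.dist x w = n + 1 + 1} =
        ⋃ b ∈ ((T.neighborFinset y).erase x : Set V), {w | T.dist b w = n ∧ T.dist y w = n + 1} := by
      ext w
      simp only [Set.mem_ofPred_eq, Set.mem_iUnion, Finset.mem_coe, mem_succ, exists_prop]
      constructor
      · rintro ⟨h1, h2⟩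
        obtain ⟨b, hb, hb'⟩ := exists_adj_dist_add_one hT (v := y) (w := w)
          (by rintro rfl; simp at h1)
        refine ⟨b, ⟨?_, hb⟩, by omega, h1⟩
        rintro rfl
        omega
      · rintro ⟨b, ⟨hbx, hb⟩, h1, h2⟩
        refine ⟨h2, ?_⟩
        rcases adj_dist_cases hT w hxy.symm with h | h
        · omega
        · exact absurd (adj_dist_unique hT hb hxy.symm (by omega) h) hbx
    rw [hset, finsum_mem_biUnion]
    · rw [finsum_mem_coe_finset]
      have : ∀ b ∈ (T.neighborFinset y).erase x,
          ∑ᶠ w ∈ {w | T.dist b w = n ∧ T.dist y w = n + 1}, F w =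
          K (!c y) * (step T)^[n] (fun _ z => F z) y b := by
        intro b hb
        rw [hF F y b (mem_succ.1 hb).2, color_eq_not (mem_succ.1 hb).2]
      rw [Finset.sum_congr rfl this, ← Finset.mul_sum, Function.iterate_succ_apply', step,
        ← Finset.card_mul_expect, card_succ hxy, hd]
      ring
    · intro b hb b' hb' hne
      refine Set.disjoint_left.2 fun w hw hw' => hne ?_
      simp only [Finset.mem_coe, mem_succ] at hb hb'
      exact adj_dist_unique hT hb.2 hb'.2 (by rw [hw.1, hw.2]) (by rw [hw'.1, hw'.2])
    · exact Finset.finite_toSet _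
    · intro b _
      exact (finite_sphere hT n b).subset fun w hw => hw.1

theorem finsum_sphere (hT : T.IsTree) (c : T.Coloring Bool) (d : Bool → ℕ)
    (hd : ∀ v, T.degree v = d (c v)) (hd3 : ∀ i, 3 ≤ d i) (n : ℕ) (v : V) :
    ∃ K : ℝ, 0 < K ∧ ∀ F : V → ℝ, ∑ᶠ w ∈ {w | T.dist v w = n + 1}, F w =
        K * 𝔼 a ∈ T.neighborFinset v, (step T)^[n] (fun _ z => F z) v a := by
  obtain ⟨K, hK, hF⟩ := finsum_forward hT c d hd hd3 n
  refine ⟨(d (c v) : ℕ) * K (!c v), ?_, fun F => ?_⟩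
  · have := hd3 (c v)
    exact mul_pos (by exact_mod_cast (by omega)) (hK _)
  have hset : {w | T.dist v w = n + 1} =
      ⋃ b ∈ (T.neighborFinset v : Set V), {w | T.dist b w = n ∧ T.dist v w = n + 1} := by
    ext w
    simp only [Set.mem_ofPred_eq, Set.mem_iUnion, Finset.mem_coe, SimpleGraph.mem_neighborFinset,
      exists_prop]
    constructor
    · intro h1
      obtain ⟨b, hb, hb'⟩ := exists_adj_dist_add_one hT (v := v) (w := w)
        (by rintro rfl; simp at h1)
      exact ⟨b, hb, by omega, h1⟩
    · rintro ⟨b, hb, h1, h2⟩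
      exact h2
  rw [hset, finsum_mem_biUnion]
  · rw [finsum_mem_coe_finset]
    have : ∀ b ∈ T.neighborFinset v,
        ∑ᶠ w ∈ {w | T.dist b w = n ∧ T.dist v w = n + 1}, F w =
        K (!c v) * (step T)^[n] (fun _ z => F z) v b := by
      intro b hb
      have hb' : T.Adj v b := by simpa using hb
      rw [hF F v b hb', color_eq_not hb']
    rw [Finset.sum_congr rfl this, ← Finset.mul_sum, ← Finset.card_mul_expect,
      SimpleGraph.card_neighborFinset_eq_degree, hd]
    ring
  · intro b hb b' hb' hne
    refine Set.disjoint_left.2 fun w hw hw' => hne ?_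
    simp only [Finset.mem_coe, SimpleGraph.mem_neighborFinset] at hb hb'
    exact adj_dist_unique hT hb hb' (by rw [hw.1, hw.2]) (by rw [hw'.1, hw'.2])
  · exact Finset.finite_toSet _
  · intro b _
    exact (finite_sphere hT n b).subset fun w hw => hw.1

theorem step_congr {f g : V → V → ℝ} {x y : V} (h : ∀ b, b ≠ x → T.Adj y b → f y b = g y b) :
    step T f x y = step T g x y :=
  Finset.expect_congr rfl fun b hb => h b (mem_succ.1 hb).1 (mem_succ.1 hb).2

theorem step_mono {f g : V → V → ℝ} {x y : V} (h : ∀ b, b ≠ x → T.Adj y b → f y b ≤ g y b) :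
    step T f x y ≤ step T g x y :=
  Finset.expect_le_expect fun b hb => h b (mem_succ.1 hb).1 (mem_succ.1 hb).2

theorem step_const {x y : V} (hd : 3 ≤ T.degree y) (k : ℝ) : step T (fun _ _ => k) x y = k :=
  Finset.expect_const (succ_nonempty hd) k

theorem iterate_step_const (hd : ∀ v, 3 ≤ T.degree v) (k : ℝ) (n : ℕ) :
    (step T)^[n] (fun _ _ => k) = fun _ _ => k := by
  have h : step T (fun _ _ => k) = fun _ _ => k := by
    funext x y
    exact step_const (hd y) k
  exact Function.iterate_fixed h n

/-- The case `F = 1` identifies the constant of `finsum_sphere` with the size of the sphere, which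
is never computed. -/
theorem iterate_step_one_finsum (hT : T.IsTree) (c : T.Coloring Bool) (d : Bool → ℕ)
    (hd : ∀ v, T.degree v = d (c v)) (hd3 : ∀ i, 3 ≤ d i) (n : ℕ) (v : V) :
    0 < ({w | T.dist v w = n + 1}.ncard : ℝ) ∧ ∀ F : V → ℝ,
      (∑ᶠ w ∈ {w | T.dist v w = n + 1}, F w) / ({w | T.dist v w = n + 1}.ncard : ℝ) =
        𝔼 a ∈ T.neighborFinset v, (step T)^[n] (fun _ z => F z) v a := by
  obtain ⟨K, hK, hF⟩ := finsum_sphere hT c d hd hd3 n v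
  have hd3' : ∀ v, 3 ≤ T.degree v := fun v => by rw [hd]; exact hd3 _
  have hne : (T.neighborFinset v).Nonempty := by
    rw [← Finset.card_pos, SimpleGraph.card_neighborFinset_eq_degree]
    have := hd3' v
    omega
  have h1 : ({w | T.dist v w = n + 1}.ncard : ℝ) = K := by
    have := hF (fun _ => 1)
    rw [iterate_step_const hd3', Finset.expect_const hne, mul_one] at this
    rw [← this, finsum_mem_eq_finite_toFinset_sum _ (finite_sphere hT (n + 1) v),
      Set.ncard_eq_toFinset_card _ (finite_sphere hT (n + 1) v)]
    simp
  rw [h1]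
  refine ⟨hK, fun F => ?_⟩
  rw [hF F, mul_div_cancel_left₀ _ hK.ne']

/-- The shift by one arises because an edge out of `v` already ends at distance `1`. -/
theorem sphereProj_real {hT : T.IsTree} (Γ : Subgroup (treeAut T hT)) (c : T.Coloring Bool)
    (d : Bool → ℕ)
    (hd : ∀ v, T.degree v = d (c v)) (hd3 : ∀ i, 3 ≤ d i) (n : ℕ) (v : V) (A : Set (VQ Γ)) :
    (sphereProj Γ v (n + 1)).real A = 𝔼 a ∈ T.neighborFinset v,
      (step T)^[n] (fun _ z => A.indicator 1 (proj Γ z)) v a := by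
  rw [← (iterate_step_one_finsum hT c d hd hd3 n v).2]
  let _ : MeasurableSpace V := ⊤
  have hfin := finite_sphere hT (n + 1) v
  have hm : ∀ B : Set V, MeasurableSet B := fun _ => MeasurableSpace.measurableSet_top
  have hp : Measurable (proj Γ) := fun _ _ => hm _
  classical
  rw [sphereProj, Measure.real, Measure.map_apply hp MeasurableSpace.measurableSet_top,
    sphereUniform, ProbabilityTheory.uniformOn, ProbabilityTheory.cond_apply (hm _),
    Measure.count_apply_finite _ hfin, Measure.count_apply_finite _ (hfin.inter_of_left _),
    ENNReal.toReal_mul, ENNReal.toReal_inv, ENNReal.toReal_natCast, ENNReal.toReal_natCast,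
    div_eq_inv_mul, Set.ncard_eq_toFinset_card _ hfin]
  congr 1
  rw [finsum_mem_eq_finite_toFinset_sum _ hfin]
  simp only [Set.indicator_apply, Pi.one_apply, Finset.sum_boole]
  congr 2
  ext w
  simp

end Spheres

/-! ### Averages over the homogeneous space -/

section Haar

open scoped BigOperators

variable {V : Type*} {T : SimpleGraph V} {hT : T.IsTree} {Γ : Subgroup (treeAut T hT)}
  {S : Type*}

/-- The Borel `σ`-algebra on `Aut(T) ⧸ Γ`. -/
instance borelQuotient : MeasurableSpace (treeAut T hT ⧸ Γ) := borel _

instance borelSpaceQuotient : BorelSpace (treeAut T hT ⧸ Γ) := ⟨rfl⟩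

/-- `f` is invariant under the diagonal action of `Γ`. -/
def Invariant (Γ : Subgroup (treeAut T hT)) (f : V → V → S) : Prop :=
  ∀ γ ∈ Γ, ∀ x y, f (γ.1 x) (γ.1 y) = f x y

/-- The function `gΓ ↦ f (g⁻¹ x) (g⁻¹ y)` on `Aut(T) ⧸ Γ` given by an invariant function `f`. -/
noncomputable def pull (Γ : Subgroup (treeAut T hT)) (f : V → V → S) (x y : V)
    (q : treeAut T hT ⧸ Γ) : S :=
  f ((q.out)⁻¹.1 x) ((q.out)⁻¹.1 y)

theorem pull_mk {f : V → V → S} (hf : Invariant Γ f) (x y : V) (g : treeAut T hT) :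
    pull Γ f x y (g : treeAut T hT ⧸ Γ) = f (g⁻¹.1 x) (g⁻¹.1 y) := by
  obtain ⟨γ, hγ⟩ := QuotientGroup.mk_out_eq_mul Γ g
  unfold pull
  rw [hγ, mul_inv_rev]
  exact hf _ (Γ.inv_mem γ.2) _ _

theorem isOpen_stabilizer_coset (u x : V) : IsOpen {g : treeAut T hT | g.1 u = x} := by
  let _ : TopologicalSpace V := ⊥
  have _ : DiscreteTopology V := ⟨rfl⟩
  have h1 : Continuous fun g : treeAut T hT => (fun v => g.1 v : V → V) :=
    continuous_induced_dom.comp continuous_subtype_val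
  have h2 : Continuous fun g : treeAut T hT => g.1 u := (continuous_apply u).comp h1
  exact (isOpen_discrete ({x} : Set V)).preimage h2

theorem inv_apply_eq_iff (g : treeAut T hT) (u x : V) : g⁻¹.1 x = u ↔ g.1 u = x := by
  constructor
  · rintro rfl
    exact RelIso.apply_inv_self g.1 x
  · rintro rfl
    exact RelIso.inv_apply_self g.1 u

/-- The value at `gΓ` depends only on `g⁻¹ x` and `g⁻¹ y`, and stabilizers of vertices are open; so
the function is locally constant and measurable for any `σ`-algebra on `S`. -/
theorem isOpen_pull_preimage {f : V → V → S} (hf : Invariant Γ f) (x y : V) (s : Set S) :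
    IsOpen (pull Γ f x y ⁻¹' s) := by
  rw [← isQuotientMap_quotient_mk'.isOpen_preimage]
  change IsOpen ((fun g : treeAut T hT => (g : treeAut T hT ⧸ Γ)) ⁻¹' (pull Γ f x y ⁻¹' s))
  have : ((fun g : treeAut T hT => (g : treeAut T hT ⧸ Γ)) ⁻¹' (pull Γ f x y ⁻¹' s)) =
      ⋃ p ∈ {p : V × V | f p.1 p.2 ∈ s},
        ({g : treeAut T hT | g.1 p.1 = x} ∩ {g : treeAut T hT | g.1 p.2 = y}) := by
    ext g
    simp only [Set.mem_preimage, pull_mk hf, Set.mem_iUnion, Set.mem_inter_iff, Set.mem_ofPred_eq,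
      exists_prop]
    constructor
    · intro h
      exact ⟨(g⁻¹.1 x, g⁻¹.1 y), h, (inv_apply_eq_iff g _ _).1 rfl, (inv_apply_eq_iff g _ _).1 rfl⟩
    · rintro ⟨p, hp, h1, h2⟩
      rwa [(inv_apply_eq_iff g _ _).2 h1, (inv_apply_eq_iff g _ _).2 h2]
  rw [this]
  exact isOpen_biUnion fun p _ => (isOpen_stabilizer_coset _ _).inter (isOpen_stabilizer_coset _ _)

theorem measurable_pull [MeasurableSpace S] {f : V → V → S} (hf : Invariant Γ f) (x y : V) :
    Measurable (pull Γ f x y) :=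
  fun _ _ => (isOpen_pull_preimage hf x y _).measurableSet

theorem pull_smul {f : V → V → S} (hf : Invariant Γ f) (x y : V) (h : treeAut T hT)
    (q : treeAut T hT ⧸ Γ) : pull Γ f (h.1 x) (h.1 y) (h • q) = pull Γ f x y q := by
  induction q using QuotientGroup.induction_on with
  | H g =>
    change pull Γ f _ _ ((h * g : treeAut T hT) : treeAut T hT ⧸ Γ) = _
    rw [pull_mk hf, pull_mk hf, mul_inv_rev]
    change f (g⁻¹.1 (h⁻¹.1 (h.1 x))) (g⁻¹.1 (h⁻¹.1 (h.1 y))) = _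
    rw [(inv_apply_eq_iff h _ _).2 rfl, (inv_apply_eq_iff h _ _).2 rfl]

variable (m : Measure (treeAut T hT ⧸ Γ)) [IsProbabilityMeasure m]

/-- `m` is invariant under `Aut(T)`. -/
def InvMeasure (m : Measure (treeAut T hT ⧸ Γ)) : Prop :=
  ∀ g : treeAut T hT, Measure.map (fun x : treeAut T hT ⧸ Γ => g • x) m = m

/-- The average over `Aut(T) ⧸ Γ` of `f (g⁻¹ x) (g⁻¹ y)`. -/
noncomputable def mean (f : V → V → ℝ) (x y : V) : ℝ := ∫ q, pull Γ f x y q ∂m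

/-- The push-forward along a map that is not a.e. measurable is `0` by convention, and invariance of
a probability measure excludes this. -/
theorem aemeasurable_smul {m : Measure (treeAut T hT ⧸ Γ)} [IsProbabilityMeasure m]
    (hm : InvMeasure m) (g : treeAut T hT) :
    AEMeasurable (fun x : treeAut T hT ⧸ Γ => g • x) m := by
  by_contra h
  have := hm g
  rw [Measure.map_of_not_aemeasurable h] at this
  exact IsProbabilityMeasure.ne_zero m this.symm

theorem map_pull_smul {m : Measure (treeAut T hT ⧸ Γ)} [IsProbabilityMeasure m]
    (hm : InvMeasure m) [MeasurableSpace S] {f : V → V → S} (hf : Invariant Γ f) (x y : V)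
    (h : treeAut T hT) :
    Measure.map (pull Γ f (h.1 x) (h.1 y)) m = Measure.map (pull Γ f x y) m := by
  have h1 : Measure.map (pull Γ f (h.1 x) (h.1 y)) (Measure.map (fun q => h • q) m) =
      Measure.map (pull Γ f (h.1 x) (h.1 y) ∘ fun q => h • q) m :=
    AEMeasurable.map_map_of_aemeasurable (measurable_pull hf _ _).aemeasurable
      (aemeasurable_smul hm h)
  rw [hm h] at h1
  rw [h1]
  congr 1
  funext q
  exact pull_smul hf x y h q

variable {m} in
theorem mean_smul (hm : InvMeasure m) {f : V → V → ℝ} (hf : Invariant Γ f) (x y : V)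
    (h : treeAut T hT) : mean m f (h.1 x) (h.1 y) = mean m f x y := by
  have key : ∀ x y, mean m f x y = ∫ t, t ∂(Measure.map (pull Γ f x y) m) := fun x y =>
    (integral_map (measurable_pull hf x y).aemeasurable
      measurable_id.aestronglyMeasurable).symm
  rw [key, key, map_pull_smul hm hf]

theorem integrable_pull {f : V → V → ℝ} (hf : Invariant Γ f) {B : ℝ} (hB : ∀ x y, |f x y| ≤ B)
    (x y : V) : Integrable (pull Γ f x y) m :=
  Integrable.of_bound (measurable_pull hf x y).aestronglyMeasurable B
    (Eventually.of_forall fun _ => hB _ _)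

theorem mean_mono {f g : V → V → ℝ} (hf : Invariant Γ f) (hg : Invariant Γ g) {B : ℝ}
    (hB : ∀ x y, |f x y| ≤ B) (hB' : ∀ x y, |g x y| ≤ B) {x y : V} (hxy : T.Adj x y)
    (h : ∀ u w, T.Adj u w → f u w ≤ g u w) : mean m f x y ≤ mean m g x y :=
  integral_mono (integrable_pull m hf hB x y) (integrable_pull m hg hB' x y)
    fun q => h _ _ ((q.out)⁻¹.1.map_rel_iff.2 hxy)

theorem mean_eq_of_color [T.LocallyFinite] {m : Measure (treeAut T hT ⧸ Γ)}
    [IsProbabilityMeasure m] (hm : InvMeasure m) (c : T.Coloring Bool)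
    (hdeg : ∀ v w, c v = c w → T.degree v = T.degree w) {f : V → V → ℝ} (hf : Invariant Γ f)
    {u y u' y' : V} (h : T.Adj u y) (h' : T.Adj u' y') (hc : c u = c u') :
    mean m f u y = mean m f u' y' := by
  obtain ⟨g, h1, h2⟩ := exists_treeAut_dart hT c hdeg h h' hc
  rw [← h1, ← h2, mean_smul hm hf]

section Step

variable [DecidableEq V] [T.LocallyFinite]

theorem step_smul (f : V → V → ℝ) (g : treeAut T hT) (x y : V) :
    step T f (g.1 x) (g.1 y) = step T (fun u w => f (g.1 u) (g.1 w)) x y := by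
  symm
  refine Finset.expect_bij (fun b _ => g.1 b) ?_ ?_ ?_ ?_
  · intro b hb
    rw [mem_succ] at hb ⊢
    exact ⟨fun h => hb.1 (g.1.injective h), g.1.map_rel_iff.2 hb.2⟩
  · intro b _
    rfl
  · intro b _ b' _ h
    exact g.1.injective h
  · intro b hb
    rw [mem_succ] at hb
    refine ⟨g⁻¹.1 b, ?_, (inv_apply_eq_iff g _ _).1 rfl⟩
    rw [mem_succ]
    have hgb : g.1 (g⁻¹.1 b) = b := (inv_apply_eq_iff g _ _).1 rfl
    refine ⟨fun h => hb.1 ?_, ?_⟩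
    · rw [← h, hgb]
    · rw [← g.1.map_rel_iff, hgb]
      exact hb.2

theorem Invariant.step {f : V → V → ℝ} (hf : Invariant Γ f) : Invariant Γ (step T f) := by
  intro γ hγ x y
  rw [step_smul f γ x y]
  exact step_congr fun b _ _ => hf γ hγ _ _

theorem Invariant.iterate_step {f : V → V → ℝ} (hf : Invariant Γ f) (n : ℕ) :
    Invariant Γ ((TreeLattice.step T)^[n] f) := by
  induction n with
  | zero => exact hf
  | succ n ih => rw [Function.iterate_succ_apply']; exact ih.step

theorem abs_step_le {f : V → V → ℝ} {B : ℝ} (hB : ∀ x y, |f x y| ≤ B) (x y : V) :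
    |step T f x y| ≤ B := by
  by_cases h : ((T.neighborFinset y).erase x).Nonempty
  · exact (Finset.abs_expect_le _ _).trans (Finset.expect_le h fun b _ => hB _ _)
  · rw [Finset.not_nonempty_iff_eq_empty] at h
    rw [step, h, Finset.expect_empty, abs_zero]
    exact (abs_nonneg _).trans (hB x y)

theorem abs_iterate_step_le {f : V → V → ℝ} {B : ℝ} (hB : ∀ x y, |f x y| ≤ B) (n : ℕ) :
    ∀ x y, |(step T)^[n] f x y| ≤ B := by
  induction n with
  | zero => exact hB
  | succ n ih => rw [Function.iterate_succ_apply']; exact abs_step_le ih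

/-- By transitivity all continuations `(y, b)` have the same mean, so averaging over them changes
nothing. -/
theorem mean_step {m : Measure (treeAut T hT ⧸ Γ)} [IsProbabilityMeasure m] (hm : InvMeasure m)
    (c : T.Coloring Bool)
    (hdeg : ∀ v w, c v = c w → T.degree v = T.degree w) (hd3 : ∀ v, 3 ≤ T.degree v)
    {f : V → V → ℝ} (hf : Invariant Γ f)
    {B : ℝ} (hB : ∀ x y, |f x y| ≤ B) {x y u w : V} (hxy : T.Adj x y) (huw : T.Adj u w)
    (hc : c u = !c x) : mean m (step T f) x y = mean m f u w := by
  have h1 : ∀ q : treeAut T hT ⧸ Γ, pull Γ (step T f) x y q =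
      𝔼 b ∈ (T.neighborFinset y).erase x, pull Γ f y b q := by
    intro q
    unfold pull
    rw [step_smul f _ x y]
    rfl
  unfold mean
  simp_rw [h1, Finset.expect_eq_sum_div_card]
  rw [integral_div, integral_finsetSum _ fun b _ => integrable_pull m hf hB y b]
  rw [← Finset.expect_eq_sum_div_card]
  change 𝔼 b ∈ (T.neighborFinset y).erase x, mean m f y b = mean m f u w
  rw [Finset.expect_congr rfl fun b hb => mean_eq_of_color hm c hdeg hf (mem_succ.1 hb).2 huw
    (by rw [hc, color_eq_not hxy])]
  exact Finset.expect_const (succ_nonempty (hd3 y)) _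

end Step

open Classical in
/-- The indicator function of the `Γ`-orbit of `(x, y)`. -/
noncomputable def orbitInd (Γ : Subgroup (treeAut T hT)) (x y u w : V) : ℝ :=
  if ∃ γ ∈ Γ, γ.1 u = x ∧ γ.1 w = y then 1 else 0

theorem orbitInd_self (x y : V) : orbitInd Γ x y x y = 1 :=
  if_pos ⟨1, Γ.one_mem, rfl, rfl⟩

theorem orbitInd_nonneg (x y u w : V) : 0 ≤ orbitInd Γ x y u w := by
  unfold orbitInd; split_ifs <;> simp

theorem abs_orbitInd_le (x y u w : V) : |orbitInd Γ x y u w| ≤ 1 := by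
  unfold orbitInd; split_ifs <;> simp

theorem orbitInd_invariant (x y : V) : Invariant Γ (orbitInd Γ x y) := by
  intro γ hγ u w
  have : (∃ δ ∈ Γ, δ.1 (γ.1 u) = x ∧ δ.1 (γ.1 w) = y) ↔ ∃ δ ∈ Γ, δ.1 u = x ∧ δ.1 w = y := by
    constructor
    · rintro ⟨δ, hδ, h1, h2⟩
      exact ⟨δ * γ, Γ.mul_mem hδ hγ, h1, h2⟩
    · rintro ⟨δ, hδ, h1, h2⟩
      refine ⟨δ * γ⁻¹, Γ.mul_mem hδ (Γ.inv_mem hγ), ?_, ?_⟩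
      · change δ.1 (γ⁻¹.1 (γ.1 u)) = x
        rw [(inv_apply_eq_iff γ _ _).2 rfl, h1]
      · change δ.1 (γ⁻¹.1 (γ.1 w)) = y
        rw [(inv_apply_eq_iff γ _ _).2 rfl, h2]
  unfold orbitInd
  classical
  exact if_congr this rfl rfl

theorem mul_orbitInd_le {f : V → V → ℝ} (hf : Invariant Γ f) (x y : V) {u w : V}
    (h0 : 0 ≤ f u w) : f x y * orbitInd Γ x y u w ≤ f u w := by
  unfold orbitInd
  split_ifs with h
  · obtain ⟨γ, hγ, rfl, rfl⟩ := h
    rw [hf γ hγ, mul_one]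
  · simpa using h0

/-- Were the mean `0`, then by transitivity and countability almost every coset would give `0` at
all edges with origin of this colour at once. But the translate of `(x, y)` by a representative of
the coset gives `1`. -/
theorem mean_orbitInd_pos [T.LocallyFinite] {m : Measure (treeAut T hT ⧸ Γ)}
    [IsProbabilityMeasure m] (hm : InvMeasure m) (c : T.Coloring Bool)
    (hdeg : ∀ v w, c v = c w → T.degree v = T.degree w)
    {x y u w : V} (hxy : T.Adj x y) (huw : T.Adj u w) (hc : c x = c u) :
    0 < mean m (orbitInd Γ x y) u w := by
  have hnn : 0 ≤ mean m (orbitInd Γ x y) u w :=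
    integral_nonneg fun q => orbitInd_nonneg _ _ _ _
  refine lt_of_le_of_ne hnn fun h0 => ?_
  have := countable_of_locallyFinite hT
  have hae : ∀ᵐ q ∂m, ∀ p : V × V, T.Adj p.1 p.2 → c p.1 = c x →
      pull Γ (orbitInd Γ x y) p.1 p.2 q = 0 := by
    rw [ae_all_iff]
    intro p
    by_cases hp : T.Adj p.1 p.2 ∧ c p.1 = c x
    · have h1 := mean_eq_of_color hm c hdeg (orbitInd_invariant (Γ := Γ) x y) hp.1 huw
        (hp.2.trans hc)
      rw [← h0, mean, integral_eq_zero_iff_of_nonneg (f := pull Γ (orbitInd Γ x y) p.1 p.2) (fun q => orbitInd_nonneg x y _ _)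
        (integrable_pull m (orbitInd_invariant x y) (abs_orbitInd_le x y) _ _)] at h1
      filter_upwards [h1] with q hq _ _ using hq
    · exact Eventually.of_forall fun q h1 h2 => absurd ⟨h1, h2⟩ hp
  have hne : (ae m).NeBot := ae_neBot.2 (IsProbabilityMeasure.ne_zero m)
  obtain ⟨q, hq⟩ := hae.exists
  have h2 := hq (q.out.1 x, q.out.1 y) (q.out.1.map_rel_iff.2 hxy) (color_smul c _ _)
  unfold pull at h2
  rw [(inv_apply_eq_iff _ _ _).2 rfl, (inv_apply_eq_iff _ _ _).2 rfl, orbitInd_self] at h2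
  exact one_ne_zero h2

end Haar

/-! ### Mixing by second moments -/

section Mixing

open scoped BigOperators

variable {V : Type*} {T : SimpleGraph V} {hT : T.IsTree} {Γ : Subgroup (treeAut T hT)}

/-- One squared deviation is at most the sum of all of them, which is the cardinality times the
variance. -/
theorem sq_sub_expect_le {ι : Type*} (s : Finset ι) (f : ι → ℝ) {a : ι} (ha : a ∈ s) :
    (f a - 𝔼 b ∈ s, f b) ^ 2 ≤ s.card * (𝔼 b ∈ s, f b ^ 2 - (𝔼 b ∈ s, f b) ^ 2) := by
  set E := 𝔼 b ∈ s, f b with hE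
  have h1 : (f a - E) ^ 2 ≤ ∑ b ∈ s, (f b - E) ^ 2 :=
    Finset.single_le_sum (f := fun b => (f b - E) ^ 2) (fun b _ => sq_nonneg _) ha
  have h2 : ∑ b ∈ s, (f b - E) ^ 2 = ∑ b ∈ s, f b ^ 2 - 2 * E * ∑ b ∈ s, f b + s.card * E ^ 2 := by
    rw [Finset.mul_sum, ← Finset.sum_sub_distrib, ← nsmul_eq_mul, ← Finset.sum_const,
      ← Finset.sum_add_distrib]
    exact Finset.sum_congr rfl fun b _ => by ring
  rw [h2, ← Finset.card_mul_expect s f, ← Finset.card_mul_expect s (fun b => f b ^ 2), ← hE] at h1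
  linarith

variable {m : Measure (treeAut T hT ⧸ Γ)}

theorem mean_const_mul (f : V → V → ℝ) (k : ℝ) (x y : V) :
    mean m (fun u w => k * f u w) x y = k * mean m f x y :=
  integral_const_mul k _

variable [IsProbabilityMeasure m]

theorem mean_sub {f g : V → V → ℝ} (hf : Invariant Γ f) (hg : Invariant Γ g) {B B' : ℝ}
    (hB : ∀ x y, |f x y| ≤ B) (hB' : ∀ x y, |g x y| ≤ B') (x y : V) :
    mean m (fun u w => f u w - g u w) x y = mean m f x y - mean m g x y :=
  integral_sub (integrable_pull m hf hB x y) (integrable_pull m hg hB' x y)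

variable [DecidableEq V] [T.LocallyFinite]

theorem tendsto_step_sub (hm : InvMeasure m) (c : T.Coloring Bool)
    (hdeg : ∀ v w, c v = c w → T.degree v = T.degree w) (hd3 : ∀ v, 3 ≤ T.degree v)
    {f : V → V → ℝ} (hf : Invariant Γ f) {B : ℝ} (hB : ∀ x y, |f x y| ≤ B)
    {x y a : V} (hx : T.Adj x y) (ha : T.Adj y a) (hax : a ≠ x) :
    Tendsto (fun n => (step T)^[n] f y a - (step T)^[n + 1] f x y) atTop (𝓝 0) := by
  set F : ℕ → V → V → ℝ := fun n => (step T)^[n] f with hF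
  have hFs : ∀ n, F (n + 1) = step T (F n) := fun n => Function.iterate_succ_apply' _ _ _
  have hFi : ∀ n, Invariant Γ (F n) := fun n => hf.iterate_step n
  have hFB : ∀ n x y, |F n x y| ≤ B := fun n => abs_iterate_step_le hB n
  set G : ℕ → V → V → ℝ := fun n u w => F n u w ^ 2 with hG
  have hGi : ∀ n, Invariant Γ (G n) := fun n γ hγ u w => by simp only [hG, hFi n γ hγ]
  have hGB : ∀ n x y, |G n x y| ≤ B ^ 2 := fun n x y => by
    rw [hG, abs_pow]
    exact pow_le_pow_left₀ (abs_nonneg _) (hFB n x y) 2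
  -- `Q n x y` is the variance of `F n` over the continuations of `(x, y)`.
  set Q : ℕ → V → V → ℝ := fun n u w => step T (G n) u w - G (n + 1) u w with hQ
  have hQi : ∀ n, Invariant Γ (Q n) := fun n γ hγ u w => by
    simp only [hQ, (hGi n).step γ hγ, hGi (n + 1) γ hγ]
  have hQB : ∀ n x y, |Q n x y| ≤ 2 * B ^ 2 := fun n x y =>
    (abs_sub _ _).trans (by linarith [abs_step_le (T := T) (hGB n) x y, hGB (n + 1) x y])
  have hQlow : ∀ n x y b, b ≠ x → T.Adj y b →
      (F n y b - F (n + 1) x y) ^ 2 ≤ ((T.neighborFinset y).erase x).card * Q n x y := by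
    intro n x y b hb hyb
    simp only [hQ, hG, hFs]
    exact sq_sub_expect_le _ (fun b => F n y b) (mem_succ.2 ⟨hb, hyb⟩)
  have hQ0 : ∀ n x y, 0 ≤ Q n x y := by
    intro n x y
    obtain ⟨b, hb⟩ := succ_nonempty (x := x) (hd3 y)
    have h1 := hQlow n x y b (mem_succ.1 hb).1 (mem_succ.1 hb).2
    have h2 : (0 : ℝ) < ((T.neighborFinset y).erase x).card := by
      exact_mod_cast Finset.card_pos.2 ⟨b, hb⟩
    exact nonneg_of_mul_nonneg_right ((sq_nonneg _).trans h1) h2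
  have hmQ : ∀ n {u w : V}, T.Adj u w →
      mean m (Q n) u w = mean m (G n) w u - mean m (G (n + 1)) u w := by
    intro n u w huw
    rw [hQ]
    rw [mean_sub (hGi n).step (hGi (n + 1)) (abs_step_le (hGB n)) (hGB (n + 1)),
      mean_step hm c hdeg hd3 (hGi n) (hGB n) huw huw.symm (color_eq_not huw)]
  have hmQ0 : ∀ n u w, 0 ≤ mean m (Q n) u w := fun n u w => integral_nonneg fun q => hQ0 _ _ _
  -- A step reverses the orientation in the mean, so second moments telescope only after summing
  -- over both orientations.
  set s : ℕ → ℝ := fun n => mean m (G n) x y + mean m (G n) y x with hs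
  have hmQs : ∀ n, mean m (Q n) x y ≤ s n - s (n + 1) := by
    intro n
    have h1 := hmQ n hx
    have h2 := hmQ n hx.symm
    have h3 := hmQ0 n y x
    simp only [hs]
    linarith
  have hanti : Antitone s := antitone_nat_of_succ_le fun n => by
    linarith [hmQs n, hmQ0 n x y]
  have hbdd : BddBelow (Set.range s) := ⟨0, by
    rintro _ ⟨n, rfl⟩
    exact add_nonneg (integral_nonneg fun q => sq_nonneg _) (integral_nonneg fun q => sq_nonneg _)⟩
  have hlim := tendsto_atTop_ciInf hanti hbdd
  have hlim0 : Tendsto (fun n => s n - s (n + 1)) atTop (𝓝 0) := by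
    have := hlim.sub ((tendsto_add_atTop_iff_nat 1).2 hlim)
    rwa [sub_self] at this
  set δ := mean m (orbitInd Γ x y) x y with hδ
  have hδ0 : 0 < δ := mean_orbitInd_pos hm c hdeg hx hx rfl
  -- `Q n` is constant on the orbit of `(x, y)`, which has mass `δ`; so a small mean forces a small
  -- value there.
  have hpt : ∀ n, Q n x y * δ ≤ s n - s (n + 1) := by
    intro n
    rw [hδ, ← mean_const_mul]
    refine (mean_mono m (B := 2 * B ^ 2) (fun γ hγ u w => ?_) (hQi n) (fun u w => ?_) (hQB n) hx
      fun u w _ => mul_orbitInd_le (hQi n) x y (hQ0 n u w)).trans (hmQs n)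
    · simp only [orbitInd_invariant x y γ hγ]
    · rw [abs_mul]
      calc |Q n x y| * |orbitInd Γ x y u w| ≤ |Q n x y| * 1 :=
            mul_le_mul_of_nonneg_left (abs_orbitInd_le _ _ _ _) (abs_nonneg _)
        _ ≤ _ := by rw [mul_one]; exact hQB n x y
  set k : ℝ := (((T.neighborFinset y).erase x).card : ℝ) with hk
  have hsq : Tendsto (fun n => (F n y a - F (n + 1) x y) ^ 2) atTop (𝓝 0) := by
    refine squeeze_zero (fun n => sq_nonneg _) (fun n => ?_)
      (by simpa using hlim0.const_mul (k / δ))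
    refine (hQlow n x y a hax ha).trans ?_
    rw [div_mul_eq_mul_div, le_div_iff₀ hδ0, mul_assoc]
    exact mul_le_mul_of_nonneg_left (hpt n) (Nat.cast_nonneg _)
  have := hsq.sqrt
  simp only [Real.sqrt_sq_eq_abs, Real.sqrt_zero] at this
  exact (tendsto_zero_iff_abs_tendsto_zero _).2 this

theorem exists_two_neighbors {y x : V} (hd : 3 ≤ T.degree y) :
    ∃ b b', b ≠ x ∧ b' ≠ x ∧ b ≠ b' ∧ T.Adj y b ∧ T.Adj y b' := by
  have h1 : 1 < ((T.neighborFinset y).erase x).card := by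
    have := Finset.pred_card_le_card_erase (s := T.neighborFinset y) (a := x)
    rw [SimpleGraph.card_neighborFinset_eq_degree] at this
    omega
  obtain ⟨b, hb, b', hb', h⟩ := Finset.one_lt_card.1 h1
  rw [mem_succ] at hb hb'
  exact ⟨b, b', hb.1, hb'.1, h, hb.2, hb'.2⟩

/-- Backtracking, `a = x`, is replaced by a detour over two further neighbours of `y`. With `F n`
the `n`-th iterate, `F n` at `(y, x)` is compared in turn with `F (n + 1)` at `(b, y)`, `F n` at
`(y, b')` and `F (n + 1)` at `(x, y)`. -/
theorem tendsto_out_sub_in (hm : InvMeasure m) (c : T.Coloring Bool)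
    (hdeg : ∀ v w, c v = c w → T.degree v = T.degree w) (hd3 : ∀ v, 3 ≤ T.degree v)
    {f : V → V → ℝ} (hf : Invariant Γ f) {B : ℝ} (hB : ∀ x y, |f x y| ≤ B)
    {x y a : V} (hx : T.Adj x y) (ha : T.Adj y a) :
    Tendsto (fun n => (step T)^[n] f y a - (step T)^[n + 1] f x y) atTop (𝓝 0) := by
  by_cases hax : a = x
  · subst hax
    obtain ⟨b, b', hb, hb', hbb, hyb, hyb'⟩ := exists_two_neighbors (x := a) (hd3 y)
    have h1 := tendsto_step_sub hm c hdeg hd3 hf hB hyb.symm ha hb.symm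
    have h2 := tendsto_step_sub hm c hdeg hd3 hf hB hyb.symm hyb' hbb.symm
    have h3 := tendsto_step_sub hm c hdeg hd3 hf hB hx hyb' hb'
    have := (h1.sub h2).add h3
    simp only [sub_zero, add_zero] at this
    exact this.congr fun n => by ring
  · exact tendsto_step_sub hm c hdeg hd3 hf hB hx ha hax

theorem tendsto_sub_of_color_eq (hm : InvMeasure m) (c : T.Coloring Bool)
    (hdeg : ∀ v w, c v = c w → T.degree v = T.degree w) (hd3 : ∀ v, 3 ≤ T.degree v)
    {f : V → V → ℝ} (hf : Invariant Γ f) {B : ℝ} (hB : ∀ x y, |f x y| ≤ B)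
    {x a z b : V} (ha : T.Adj x a) (hb : T.Adj z b) (hc : c x = c z) :
    Tendsto (fun n => (step T)^[n] f x a - (step T)^[n] f z b) atTop (𝓝 0) := by
  set L : V → V → V → V → Prop := fun x a z b =>
    Tendsto (fun n => (step T)^[n] f x a - (step T)^[n] f z b) atTop (𝓝 0) with hL
  have trans : ∀ {x a z b u w}, L x a z b → L z b u w → L x a u w := by
    intro x a z b u w h1 h2
    have := h1.add h2
    rw [add_zero] at this
    exact this.congr fun n => by ring
  have key : ∀ {x y a : V}, T.Adj x y → T.Adj y a →
      Tendsto (fun n => (step T)^[n] f y a - (step T)^[n + 1] f x y) atTop (𝓝 0) :=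
    fun hx ha => tendsto_out_sub_in hm c hdeg hd3 hf hB hx ha
  have out : ∀ {y a a'}, T.Adj y a → T.Adj y a' → L y a y a' := by
    intro y a a' h h'
    have := (key h.symm h).sub (key h.symm h')
    rw [sub_zero] at this
    exact this.congr fun n => by ring
  have inn : ∀ {y a a'}, T.Adj y a → T.Adj y a' → L a y a' y := by
    intro y a a' h h'
    have := (key h'.symm h).sub (key h.symm h)
    rw [sub_zero] at this
    refine (tendsto_add_atTop_iff_nat 1).1 (this.congr fun n => by ring)
  -- Each edge of the walk is read once as leaving one endpoint and once as entering the other. This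
  -- interchanges the two roles and the colours, so the statements for equal and for different
  -- colours are proved together.
  have walk : ∀ {x z : V} (_ : T.Walk x z) {a b : V}, T.Adj x a → T.Adj z b →
      (c x = c z → L x a z b ∧ L a x b z) ∧ (c x ≠ c z → L x a b z ∧ L a x z b) := by
    intro x z p
    induction p with
    | nil => exact fun ha hb => ⟨fun _ => ⟨out ha hb, inn ha hb⟩, fun h => absurd rfl h⟩
    | @cons x x₁ z h p ih =>
      intro a b ha hb
      have h1 := out ha h
      have h2 := inn ha h
      obtain ⟨i1, i2⟩ := ih h.symm hb
      have hcx : c x₁ = !c x := color_eq_not h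
      constructor
      · intro hxz
        obtain ⟨j1, j2⟩ := i2 (by rw [hcx, hxz]; simp)
        exact ⟨trans h1 j2, trans h2 j1⟩
      · intro hxz
        obtain ⟨j1, j2⟩ := i1 (by rw [hcx]; cases h : c x <;> cases h' : c z <;> simp_all)
        exact ⟨trans h1 j2, trans h2 j1⟩
  obtain ⟨p⟩ := hT.connected.preconnected x z
  exact ((walk p ha hb).1 hc).1

/-- The mean averages values at edges of the same type as `(x, a)`, all asymptotically equal to the
value there; dominated convergence applies. -/
theorem tendsto_sub_mean (hm : InvMeasure m) (c : T.Coloring Bool)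
    (hdeg : ∀ v w, c v = c w → T.degree v = T.degree w) (hd3 : ∀ v, 3 ≤ T.degree v)
    {f : V → V → ℝ} (hf : Invariant Γ f) {B : ℝ} (hB : ∀ x y, |f x y| ≤ B)
    {x a : V} (ha : T.Adj x a) :
    Tendsto (fun n => (step T)^[n] f x a - mean m ((step T)^[n] f) x a) atTop (𝓝 0) := by
  have h1 : ∀ n, (step T)^[n] f x a - mean m ((step T)^[n] f) x a =
      ∫ q, ((step T)^[n] f x a - pull Γ ((step T)^[n] f) x a q) ∂m := by
    intro n
    rw [integral_sub (integrable_const _)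
      (integrable_pull m (hf.iterate_step n) (abs_iterate_step_le hB n) x a)]
    simp [mean]
  simp_rw [h1]
  rw [show (𝓝 (0 : ℝ)) = 𝓝 (∫ _, (0 : ℝ) ∂m) by simp]
  refine tendsto_integral_of_dominated_convergence (fun _ => 2 * B) (fun n => ?_)
    (integrable_const _) (fun n => Eventually.of_forall fun q => ?_)
    (Eventually.of_forall fun q => ?_)
  · exact (measurable_const.sub (measurable_pull (hf.iterate_step n) x a)).aestronglyMeasurable
  · rw [Real.norm_eq_abs]
    refine (abs_sub _ _).trans ?_
    have h2 := abs_iterate_step_le (T := T) hB n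
    have h3 := h2 ((q.out)⁻¹.1 x) ((q.out)⁻¹.1 a)
    unfold pull
    linarith [h2 x a]
  · exact tendsto_sub_of_color_eq hm c hdeg hd3 hf hB ha ((q.out)⁻¹.1.map_rel_iff.2 ha)
      (color_smul c _ _).symm

theorem mean_iterate_step (hm : InvMeasure m) (c : T.Coloring Bool)
    (hdeg : ∀ v w, c v = c w → T.degree v = T.degree w) (hd3 : ∀ v, 3 ≤ T.degree v)
    {f : V → V → ℝ} (hf : Invariant Γ f) {B : ℝ} (hB : ∀ x y, |f x y| ≤ B) (n : ℕ)
    {x y : V} (hxy : T.Adj x y) :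
    mean m ((step T)^[n] f) x y = if Even n then mean m f x y else mean m f y x := by
  induction n generalizing x y with
  | zero => simp
  | succ n ih =>
    rw [Function.iterate_succ_apply', mean_step hm c hdeg hd3 (hf.iterate_step n)
      (abs_iterate_step_le hB n) hxy hxy.symm (color_eq_not hxy), ih hxy.symm]
    by_cases h : Even n
    · rw [if_pos h, if_neg (by simpa [Nat.even_add_one] using h)]
    · rw [if_neg h, if_pos (by simpa [Nat.even_add_one] using h)]

theorem tendsto_iterate_step (hm : InvMeasure m) (c : T.Coloring Bool)
    (hdeg : ∀ v w, c v = c w → T.degree v = T.degree w) (hd3 : ∀ v, 3 ≤ T.degree v)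
    {f : V → V → ℝ} (hf : Invariant Γ f) {B : ℝ} (hB : ∀ x y, |f x y| ≤ B)
    {x y : V} (hxy : T.Adj x y) :
    Tendsto (fun n => (step T)^[2 * n] f x y) atTop (𝓝 (mean m f x y)) := by
  have h1 := (tendsto_sub_mean hm c hdeg hd3 hf hB hxy).comp
    (tendsto_id.const_mul_atTop' (show 0 < 2 by norm_num))
  have h2 := h1.add_const (mean m f x y)
  rw [zero_add] at h2
  refine h2.congr fun n => ?_
  simp only [Function.comp, id, mean_iterate_step hm c hdeg hd3 hf hB _ hxy]
  simp

end Mixing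

/-! ### The height along Nagao rays -/

section Height

variable {V : Type*} {T : SimpleGraph V} {hT : T.IsTree} {Γ : Subgroup (treeAut T hT)}

theorem proj_eq_iff {x y : V} : proj Γ x = proj Γ y ↔ ∃ γ ∈ Γ, γ.1 y = x := by
  constructor
  · intro h
    obtain ⟨γ, hγ⟩ := Quotient.exact h
    exact ⟨γ.1, γ.2, hγ⟩
  · rintro ⟨γ, hγ, h⟩
    exact Quotient.sound ⟨⟨γ, hγ⟩, h⟩

theorem projE_eq_iff {d d' : T.Dart} :
    projE Γ d = projE Γ d' ↔ ∃ γ : Γ, γ • d' = d :=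
  ⟨fun h => Quotient.exact h, fun ⟨γ, h⟩ => Quotient.sound ⟨γ, h⟩⟩

theorem init_rev (e : EQ Γ) : init (rev e) = term e := by
  induction e using Quotient.inductionOn with
  | h d => rfl

theorem term_rev (e : EQ Γ) : term (rev e) = init e := by
  induction e using Quotient.inductionOn with
  | h d => rfl

/-- Index `1` means that the stabilizer of `y` fixes `z`, so no other neighbour of `y` lies over the
same edge. -/
theorem eq_of_ind_eq_one {y z z' : V} (h : T.Adj y z) (h' : T.Adj y z')
    (he : projE Γ ⟨(y, z), h⟩ = projE Γ ⟨(y, z'), h'⟩) (hi : ind (projE Γ ⟨(y, z), h⟩) = 1) :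
    z = z' := by
  obtain ⟨γ, hγ⟩ := projE_eq_iff.1 he.symm
  have h1 : γ • y = y := congrArg (fun d : T.Dart => d.fst) hγ
  have h2 : γ • z = z' := congrArg (fun d : T.Dart => d.snd) hγ
  have h3 : (MulAction.stabilizer Γ (⟨(y, z), h⟩ : T.Dart)).relIndex
    (MulAction.stabilizer Γ y) = 1 := hi
  rw [Subgroup.relIndex_eq_one] at h3
  have h4 : γ • (⟨(y, z), h⟩ : T.Dart) = ⟨(y, z), h⟩ := h3 h1
  have h5 : γ • z = z := congrArg (fun d : T.Dart => d.snd) h4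
  rw [← h5, h2]

/-- The height along the Nagao rays of a geometrically finite quotient. -/
theorem exists_height (hG : IsGeometricallyFinite Γ) :
    ∃ H : V → ℕ, (∀ γ ∈ Γ, ∀ x, H (γ.1 x) = H x) ∧
      (∀ n, ∃ S : Set V, S.Finite ∧ ∀ x, H x ≤ n → ∃ γ ∈ Γ, γ.1 x ∈ S) ∧
      (∀ y b, H y ≠ 0 → T.Adj y b → H b = H y + 1 ∨ H b + 1 = H y) ∧
      (∀ y b b', H y ≠ 0 → T.Adj y b → T.Adj y b' → H b = H y + 1 → H b' = H y + 1 → b = b') := by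
  obtain ⟨F, F', m, r, hF, -, -, hF', hr0, hrs, hinj, hFc, hFc', hind, -⟩ := hG
  let t : Fin m × ℕ → VQ Γ := fun x => term (r x.1 x.2)
  -- The default `0` is the height on `F`; the vertices of an open ray have heights `1, 2, …`.
  let h : VQ Γ → ℕ := Function.extend t (fun x => x.2 + 1) 0
  have h_t : ∀ k i, h (term (r k i)) = i + 1 := fun k i => hinj.extend_apply _ _ (k, i)
  have h_F : ∀ v ∈ F, h v = 0 := by
    intro v hv
    refine Function.extend_apply' _ _ _ ?_
    rintro ⟨⟨k, i⟩, hk⟩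
    exact (hFc v).2 ⟨k, i, hk.symm⟩ hv
  have h_ne : ∀ v, h v ≠ 0 → ∃ k i, v = term (r k i) := fun v hv =>
    (hFc v).1 fun hvF => hv (h_F v hvF)
  -- Edges of `F'` and the first edges of the rays start in `F`, so only the two ray edges at this
  -- vertex remain.
  have edge : ∀ e : EQ Γ, ∀ k i, init e = term (r k i) → e = r k (i + 1) ∨ e = rev (r k i) := by
    intro e k i he
    have heF : e ∉ F' := fun hc => (hFc _).2 ⟨k, i, he⟩ (hF' e hc).1
    obtain ⟨k', i', h1 | h1⟩ := (hFc' e).1 heF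
    · rcases i' with _ | i'
      · exact absurd (by rw [← he, h1]; exact hr0 k') ((hFc _).2 ⟨k, i, rfl⟩)
      · have : (k', i') = (k, i) := hinj (by
          change term (r k' i') = term (r k i)
          rw [← he, h1, hrs])
        obtain ⟨rfl, rfl⟩ := Prod.mk.inj this
        exact Or.inl h1
    · have : (k', i') = (k, i) := hinj (by
        change term (r k' i') = term (r k i)
        rw [← he, h1, init_rev])
      obtain ⟨rfl, rfl⟩ := Prod.mk.inj this
      exact Or.inr h1
  have h_init : ∀ k i, h (init (r k i)) = i := by
    intro k i
    rcases i with _ | i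
    · exact h_F _ (hr0 k)
    · rw [hrs, h_t]
  refine ⟨fun x => h (proj Γ x), ?_, ?_, ?_, ?_⟩
  · intro γ hγ x
    have : proj Γ (γ.1 x) = proj Γ x := proj_eq_iff.2 ⟨γ, hγ, rfl⟩
    simp only [this]
  · intro n
    have hfin : {v | h v ≤ n}.Finite := by
      refine (hF.union ((Set.finite_univ (α := Fin m)).prod (Set.finite_Iic n) |>.image t)).subset ?_
      intro v hv
      by_cases hvF : v ∈ F
      · exact Or.inl hvF
      · obtain ⟨k, i, rfl⟩ := (hFc v).1 hvF
        have hv' : h (term (r k i)) ≤ n := hv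
        rw [h_t] at hv'
        exact Or.inr ⟨(k, i), ⟨trivial, by simp; omega⟩, rfl⟩
    refine ⟨(fun v : VQ Γ => (Quotient.out v : V)) '' {v | h v ≤ n}, hfin.image _, fun x hx => ?_⟩
    obtain ⟨γ, hγ, h1⟩ := proj_eq_iff.1
      (show proj Γ (Quotient.out (proj Γ x) : V) = proj Γ x from Quotient.out_eq _)
    exact ⟨γ, hγ, proj Γ x, hx, h1.symm⟩
  · intro y b hy hyb
    obtain ⟨k, i, hki⟩ := h_ne _ hy
    have hyi : h (proj Γ y) = i + 1 := by rw [hki, h_t]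
    change h (term (projE Γ ⟨(y, b), hyb⟩)) = h (proj Γ y) + 1 ∨
      h (term (projE Γ ⟨(y, b), hyb⟩)) + 1 = h (proj Γ y)
    rcases edge (projE Γ ⟨(y, b), hyb⟩) k i hki with h1 | h1
    · left; rw [h1, h_t, hyi]
    · right; rw [h1, term_rev, h_init, hyi]
  · intro y b b' hy hyb hyb' hb hb'
    obtain ⟨k, i, hki⟩ := h_ne _ hy
    have hyi : h (proj Γ y) = i + 1 := by rw [hki, h_t]
    have key : ∀ b (hyb : T.Adj y b), h (proj Γ b) = h (proj Γ y) + 1 →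
        projE Γ ⟨(y, b), hyb⟩ = r k (i + 1) := by
      intro b hyb hb
      rcases edge (projE Γ ⟨(y, b), hyb⟩) k i hki with h1 | h1
      · exact h1
      · exfalso
        change h (term (projE Γ ⟨(y, b), hyb⟩)) = _ at hb
        rw [h1, term_rev, h_init, hyi] at hb
        omega
    have e1 := key b hyb hb
    have e2 := key b' hyb' hb'
    exact eq_of_ind_eq_one hyb hyb' (e1.trans e2.symm) (by rw [e1, hind])

end Height

/-! ### A Lyapunov function -/

section Drift

open scoped BigOperators

variable {V : Type*} {T : SimpleGraph V} {hT : T.IsTree} {Γ : Subgroup (treeAut T hT)}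
  [DecidableEq V] [T.LocallyFinite]

/-- A Lyapunov function for the non-backtracking walk: it decreases on average outside a set which
is finite modulo `Γ`. -/
theorem exists_drift (hG : IsGeometricallyFinite Γ) (hd3 : ∀ v, 3 ≤ T.degree v) :
    ∃ W : V → V → ℝ, Invariant Γ W ∧ (∀ x y, 0 ≤ W x y) ∧
      (∀ x y, T.Adj x y → step T W x y ≤ 7 / 8 * W x y + 5) ∧
      ∀ R : ℝ, ∃ D : Set (V × V), D.Finite ∧ ∀ x y, T.Adj x y → W x y ≤ R →
        ∃ γ ∈ Γ, (γ.1 x, γ.1 y) ∈ D := by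
  obtain ⟨H, hinv, hfin, hnb, huniq⟩ := exists_height hG
  -- The factor `4` charges edges that point up a ray. After a downward edge `(x, y)` with `H y ≠ 0`
  -- the only way up is back to `x`, so the walk descends and `W` shrinks by `4 / 5`. After an
  -- upward edge, with `p = (5 / 4) ^ H y`, at least two continuations exist and at most one climbs
  -- on, with weight `5 * p`, the others having weight `p`; the average is at most `p + 5 * p / 2 =
  -- 7 / 8 * (4 * p)`. After an edge ending at height `0` all weights are at most `5`.
  set W : V → V → ℝ := fun x y => if H x < H y then 4 * (5 / 4) ^ H y else (5 / 4) ^ H x with hW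
  have one_le : ∀ n : ℕ, (1 : ℝ) ≤ (5 / 4) ^ n := fun n => one_le_pow₀ (by norm_num)
  have hup : ∀ x y, H x < H y → W x y = 4 * (5 / 4) ^ H y := fun x y h => if_pos h
  have hdown : ∀ x y, ¬ H x < H y → W x y = (5 / 4) ^ H x := fun x y h => if_neg h
  refine ⟨W, fun γ hγ x y => by simp only [hW, hinv γ hγ], fun x y => ?_, fun x y hxy => ?_,
    fun R => ?_⟩
  · simp only [hW]; split_ifs <;> positivity
  · by_cases hy : H y = 0
    · have h1 : step T W x y ≤ 5 := by
        refine Finset.expect_le (succ_nonempty (hd3 y)) fun b hb => ?_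
        have hyb := (mem_succ.1 hb).2
        by_cases hb0 : H b = 0
        · rw [hdown _ _ (by omega), hy]; norm_num
        · have hb1 : H b = 1 := by
            rcases hnb b y hb0 hyb.symm with h | h <;> omega
          rw [hup _ _ (by omega), hb1]; norm_num
      have h2 : 0 ≤ W x y := by simp only [hW]; split_ifs <;> positivity
      linarith
    · rcases hnb y x hy hxy.symm with hx | hx
      · have h1 : step T W x y ≤ (5 / 4) ^ H y := by
          refine Finset.expect_le (succ_nonempty (hd3 y)) fun b hb => ?_
          obtain ⟨hbx, hyb⟩ := mem_succ.1 hb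
          rcases hnb y b hy hyb with h | h
          · exact absurd (huniq y b x hy hyb hxy.symm h hx) hbx
          · rw [hdown _ _ (by omega)]
        rw [hdown x y (by omega), hx, pow_succ]
        have := one_le (H y)
        linarith
      · rw [hup x y (by omega)]
        set p : ℝ := (5 / 4) ^ H y with hp
        have hp1 : 1 ≤ p := one_le _
        set s := (T.neighborFinset y).erase x with hs
        have hcard : (2 : ℝ) ≤ s.card := by
          rw [hs, card_succ hxy]
          have := hd3 y
          exact_mod_cast (by omega)
        have h1 : ∑ b ∈ s, W y b ≤ ∑ b ∈ s, (p + if H b = H y + 1 then 5 * p else 0) := by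
          refine Finset.sum_le_sum fun b hb => ?_
          obtain ⟨hbx, hyb⟩ := mem_succ.1 hb
          rcases hnb y b hy hyb with h | h
          · rw [hup _ _ (by omega), if_pos h, h, pow_succ]
            linarith
          · rw [hdown _ _ (by omega), if_neg (by omega), add_zero]
        have h2 : ∑ b ∈ s, (if H b = H y + 1 then 5 * p else 0) ≤ 5 * p := by
          rw [← Finset.sum_filter, Finset.sum_const, nsmul_eq_mul]
          have hc : (s.filter fun b => H b = H y + 1).card ≤ 1 := by
            refine Finset.card_le_one.2 fun b hb b' hb' => ?_
            rw [Finset.mem_filter, mem_succ] at hb hb'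
            exact huniq y b b' hy hb.1.2 hb'.1.2 hb.2 hb'.2
          have hc' : ((s.filter fun b => H b = H y + 1).card : ℝ) ≤ 1 := by exact_mod_cast hc
          nlinarith
        rw [Finset.sum_add_distrib, Finset.sum_const, nsmul_eq_mul] at h1
        rw [step, Finset.expect_eq_sum_div_card, div_le_iff₀ (by linarith)]
        nlinarith
  · obtain ⟨n, hn⟩ := pow_unbounded_of_one_lt R (show (1 : ℝ) < 5 / 4 by norm_num)
    obtain ⟨S, hS, hSx⟩ := hfin n
    refine ⟨⋃ x ∈ S, (fun b => (x, b)) '' (T.neighborFinset x : Set V),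
      hS.biUnion fun x _ => (Finset.finite_toSet _).image _, fun x y hxy hR => ?_⟩
    have hle : (5 / 4 : ℝ) ^ H x ≤ W x y := by
      by_cases h : H x < H y
      · rw [hup _ _ h]
        have : (5 / 4 : ℝ) ^ H x ≤ (5 / 4) ^ H y := pow_le_pow_right₀ (by norm_num) h.le
        linarith [one_le (H y)]
      · rw [hdown _ _ h]
    have hHx : H x ≤ n := by
      by_contra hc
      have : (5 / 4 : ℝ) ^ n ≤ (5 / 4) ^ H x := pow_le_pow_right₀ (by norm_num) (by omega)
      linarith
    obtain ⟨γ, hγ, hγx⟩ := hSx x hHx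
    refine ⟨γ, hγ, ?_⟩
    simp only [Set.mem_iUnion]
    exact ⟨γ.1 x, hγx, γ.1 y, by simpa using γ.1.map_rel_iff.2 hxy, rfl⟩

end Drift

/-! ### Harris' theorem: drift and minorization -/

section Ergodicity

open scoped BigOperators

variable {V : Type*} {T : SimpleGraph V} {hT : T.IsTree} {Γ : Subgroup (treeAut T hT)}
  [DecidableEq V] [T.LocallyFinite]

theorem iterate_step_affine (hd3 : ∀ v, 3 ≤ T.degree v) (k a b : ℝ) (f g : V → V → ℝ) (n : ℕ) :
    (step T)^[n] (fun u w => k + a * f u w + b * g u w) =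
      fun x y => k + a * (step T)^[n] f x y + b * (step T)^[n] g x y := by
  induction n with
  | zero => rfl
  | succ n ih =>
    simp only [Function.iterate_succ_apply', ih]
    funext x y
    simp only [step, Finset.expect_add_distrib, Finset.mul_expect,
      Finset.expect_const (succ_nonempty (hd3 y))]

theorem iterate_step_mono (c : T.Coloring Bool) {f g : V → V → ℝ} (n : ℕ) {x y : V}
    (hxy : T.Adj x y)
    (h : ∀ u w, T.Adj u w → (c u = c x ↔ Even n) → f u w ≤ g u w) :
    (step T)^[n] f x y ≤ (step T)^[n] g x y := by
  induction n generalizing x y with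
  | zero => exact h x y hxy (by simp)
  | succ n ih =>
    simp only [Function.iterate_succ_apply']
    refine step_mono fun b _ hyb => ih hyb fun u w huw hu => h u w huw ?_
    rw [color_eq_not hxy] at hu
    rw [Nat.even_add_one, ← hu]
    cases c u <;> cases c x <;> simp

theorem iterate_step_two_mul_mono (c : T.Coloring Bool) {f g : V → V → ℝ} (n : ℕ) {x y : V}
    (hxy : T.Adj x y)
    (h : ∀ u w, T.Adj u w → c u = c x → f u w ≤ g u w) :
    (step T)^[2 * n] f x y ≤ (step T)^[2 * n] g x y :=
  iterate_step_mono c _ hxy fun u w huw hu => h u w huw (hu.2 (even_two_mul n))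

/-- The constant `40` is the fixed point of `t ↦ 7 / 8 * t + 5`. -/
theorem iterate_step_drift (hd3 : ∀ v, 3 ≤ T.degree v) (c : T.Coloring Bool) {W : V → V → ℝ}
    (hdrift : ∀ x y, T.Adj x y → step T W x y ≤ 7 / 8 * W x y + 5) (n : ℕ) {x y : V}
    (hxy : T.Adj x y) : (step T)^[n] W x y ≤ (7 / 8) ^ n * W x y + 40 := by
  induction n with
  | zero => simp
  | succ n ih =>
    rw [Function.iterate_succ_apply]
    have h1 : (step T)^[n] (step T W) x y ≤
        (step T)^[n] (fun u w => 5 + 7 / 8 * W u w + 0 * W u w) x y :=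
      iterate_step_mono c n hxy fun u w huw _ => by linarith [hdrift u w huw]
    rw [iterate_step_affine hd3] at h1
    rw [pow_succ]
    linarith

/-- The intervals of radius `g e` about `F e` meet pairwise, hence have a common point, namely the
supremum of the left ends. -/
theorem exists_center {ι : Type*} {s : Set ι} (hs : s.Nonempty) {F g : ι → ℝ}
    (h : ∀ e ∈ s, ∀ e' ∈ s, F e - F e' ≤ g e + g e') : ∃ k, ∀ e ∈ s, |F e - k| ≤ g e := by
  have hbdd : ∀ e' ∈ s, ∀ t ∈ (fun e => F e - g e) '' s, t ≤ F e' + g e' := by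
    rintro e' he' _ ⟨e, he, rfl⟩
    linarith [h e he e' he']
  refine ⟨sSup ((fun e => F e - g e) '' s), fun e he => ?_⟩
  have h1 := le_csSup ⟨_, hbdd e he⟩ (Set.mem_image_of_mem (fun e => F e - g e) he)
  have h2 := csSup_le (hs.image _) (hbdd e he)
  rw [abs_le]
  constructor <;> linarith

/-- A contraction for a weighted seminorm, from a drift and a minorization condition. -/
theorem harris_contraction (hd3 : ∀ v, 3 ≤ T.degree v) (c : T.Coloring Bool) {W D : V → V → ℝ}
    (hW : Invariant Γ W) (hW0 : ∀ x y, 0 ≤ W x y) {x₀ y₀ : V} (h₀ : T.Adj x₀ y₀)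
    (hD : D = orbitInd Γ x₀ y₀)
    {N : ℕ} (hN : ∀ x y, T.Adj x y → (step T)^[2 * N] W x y ≤ 7 / 8 * W x y + 40)
    {α : ℝ} (hα : 0 < α) (hα1 : α ≤ 1)
    (hmin : ∀ x y, T.Adj x y → c x = c x₀ → W x y ≤ 1280 → α ≤ (step T)^[2 * N] D x y)
    {f : V → V → ℝ} (hf : Invariant Γ f) {M k : ℝ} (hM : 0 ≤ M)
    (hfk : ∀ x y, T.Adj x y → c x = c x₀ → |f x y - k| ≤ M * (1 + α / 80 * W x y)) :
    ∃ k', ∀ x y, T.Adj x y → c x = c x₀ →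
      |(step T)^[2 * N] f x y - k'| ≤ (1 - α / 18) * M * (1 + α / 80 * W x y) := by
  -- `A` and `A'` are the slacks of the upper and the lower bound for `f` on the orbit of `(x₀,
  -- y₀)`. Their sum is at least `2 * M`, so if both walks hit the orbit with probability at least
  -- `α`, the difference of their expectations improves by `2 * M * α`.
  set A : ℝ := M * (1 + α / 80 * W x₀ y₀) - (f x₀ y₀ - k) with hA
  set A' : ℝ := M * (1 + α / 80 * W x₀ y₀) + (f x₀ y₀ - k) with hA'
  have hf0 := abs_le.1 (hfk x₀ y₀ h₀ rfl)
  have hA0 : 0 ≤ A := by linarith [hf0.2]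
  have hA0' : 0 ≤ A' := by linarith [hf0.1]
  have hβW : ∀ x y, 0 ≤ α / 80 * W x y := fun x y => mul_nonneg (by linarith) (hW0 x y)
  have hAA : 2 * M ≤ A + A' := by
    have := mul_nonneg hM (hβW x₀ y₀)
    rw [hA, hA']
    linarith
  have hDcases : ∀ u w, D u w = 0 ∨ (D u w = 1 ∧ f u w = f x₀ y₀ ∧ W u w = W x₀ y₀) := by
    intro u w
    rw [hD]
    unfold orbitInd
    split_ifs with h
    · obtain ⟨γ, hγ, rfl, rfl⟩ := h
      exact Or.inr ⟨rfl, (hf γ hγ u w).symm, (hW γ hγ u w).symm⟩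
    · exact Or.inl rfl
  have hDn : ∀ x y, T.Adj x y → 0 ≤ (step T)^[2 * N] D x y := by
    intro x y hxy
    have := iterate_step_mono (T := T) c (f := fun _ _ => 0) (g := D) (2 * N) hxy
      fun u w _ _ => by rw [hD]; exact orbitInd_nonneg _ _ _ _
    rwa [iterate_step_const hd3] at this
  have hupper : ∀ x y, T.Adj x y → c x = c x₀ → (step T)^[2 * N] f x y ≤
      (k + M) + M * (α / 80) * (step T)^[2 * N] W x y + (-A) * (step T)^[2 * N] D x y := by
    intro x y hxy hc
    have h1 := iterate_step_two_mul_mono c (f := f)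
      (g := fun u w => (k + M) + M * (α / 80) * W u w + (-A) * D u w) N hxy fun u w huw hu => by
        have h2 := abs_le.1 (hfk u w huw (hu.trans hc))
        rcases hDcases u w with h | ⟨h, h3, h4⟩
        · rw [h]; linarith [h2.2]
        · rw [h, h3, h4, hA]; linarith
    rwa [iterate_step_affine hd3] at h1
  have hlower : ∀ x y, T.Adj x y → c x = c x₀ →
      (k - M) + (-(M * (α / 80))) * (step T)^[2 * N] W x y + A' * (step T)^[2 * N] D x y ≤
      (step T)^[2 * N] f x y := by
    intro x y hxy hc
    have h1 := iterate_step_two_mul_mono c (g := f)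
      (f := fun u w => (k - M) + (-(M * (α / 80))) * W u w + A' * D u w) N hxy fun u w huw hu => by
        have h2 := abs_le.1 (hfk u w huw (hu.trans hc))
        rcases hDcases u w with h | ⟨h, h3, h4⟩
        · rw [h]; linarith [h2.1]
        · rw [h, h3, h4, hA']; linarith
    rwa [iterate_step_affine hd3] at h1
  obtain ⟨k', hk'⟩ := exists_center (s := {p : V × V | T.Adj p.1 p.2 ∧ c p.1 = c x₀})
    ⟨(x₀, y₀), h₀, rfl⟩ (F := fun p => (step T)^[2 * N] f p.1 p.2)
    (g := fun p => (1 - α / 18) * M * (1 + α / 80 * W p.1 p.2)) (by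
      rintro ⟨x, y⟩ ⟨hxy, hx⟩ ⟨x', y'⟩ ⟨hxy', hx'⟩
      simp only at hxy hx hxy' hx' ⊢
      have h1 := hupper x y hxy hx
      have h2 := hlower x' y' hxy' hx'
      have h3 := hN x y hxy
      have h4 := hN x' y' hxy'
      have h5 := hDn x y hxy
      have h6 := hDn x' y' hxy'
      have hMα : 0 ≤ M * (α / 80) := mul_nonneg hM (by linarith)
      set S := W x y + W x' y' with hS
      have hS0 : 0 ≤ S := add_nonneg (hW0 _ _) (hW0 _ _)
      have h7 : M * (α / 80) * ((step T)^[2 * N] W x y + (step T)^[2 * N] W x' y') ≤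
          M * (α / 80) * (7 / 8 * S + 80) := mul_le_mul_of_nonneg_left (by linarith) hMα
      suffices h8 : 2 * M + M * (α / 80) * (7 / 8 * S + 80) -
          (A * (step T)^[2 * N] D x y + A' * (step T)^[2 * N] D x' y') ≤
          M * ((1 - α / 18) * (2 + α / 80 * S)) by
        have : M * ((1 - α / 18) * (2 + α / 80 * S)) =
            (1 - α / 18) * M * (1 + α / 80 * W x y) +
            (1 - α / 18) * M * (1 + α / 80 * W x' y') := by rw [hS]; ring
        linarith
      -- For small `S` the improvement `2 * α` beats the drift constant `α / 80 * 80`. For large `S`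
      -- the drift alone must yield the factor `1 - α / 18`: this needs `S * (1 / 640 - α / 1440) ≥
      -- 10 / 9`, an equality for `S = 1280` and `α = 1`.
      by_cases hSR : S ≤ 1280
      · have h9 := hmin x y hxy hx (by linarith [hW0 x' y'])
        have h10 := hmin x' y' hxy' hx' (by linarith [hW0 x y])
        have h11 := mul_le_mul_of_nonneg_left h9 hA0
        have h12 := mul_le_mul_of_nonneg_left h10 hA0'
        have h13 : 2 * M * α ≤ (A + A') * α := mul_le_mul_of_nonneg_right hAA hα.le
        have h14 : M * (2 + α / 80 * (7 / 8 * S + 80) - 2 * α) ≤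
            M * ((1 - α / 18) * (2 + α / 80 * S)) := by
          refine mul_le_mul_of_nonneg_left ?_ hM
          have : 0 ≤ α * S * (1 - α) := mul_nonneg (mul_nonneg hα.le hS0) (by linarith)
          have : 0 ≤ α * S := mul_nonneg hα.le hS0
          nlinarith
        linarith
      · have h11 := mul_nonneg hA0 h5
        have h12 := mul_nonneg hA0' h6
        have h14 : M * (2 + α / 80 * (7 / 8 * S + 80)) ≤
            M * ((1 - α / 18) * (2 + α / 80 * S)) := by
          refine mul_le_mul_of_nonneg_left ?_ hM
          have h15 : 0 ≤ α * S * (1 - α) := mul_nonneg (mul_nonneg hα.le hS0) (by linarith)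
          have h16 : α * 1280 ≤ α * S := mul_le_mul_of_nonneg_left (by linarith) hα.le
          nlinarith
        linarith)
  exact ⟨k', fun x y hxy hx => hk' (x, y) ⟨hxy, hx⟩⟩

variable {m : Measure (treeAut T hT ⧸ Γ)} [IsProbabilityMeasure m]

/-- The iterates of the orbit indicator converge to its mean `δ > 0`, so some even iterate is at
least `δ / 2` at all relevant edges of the finite set `D`, and by invariance at their translates. -/
theorem exists_minorization (hm : InvMeasure m) (c : T.Coloring Bool)
    (hdeg : ∀ v w, c v = c w → T.degree v = T.degree w) (hd3 : ∀ v, 3 ≤ T.degree v)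
    {x₀ y₀ : V} (h₀ : T.Adj x₀ y₀) {D : Set (V × V)} (hD : D.Finite) :
    ∃ α : ℝ, 0 < α ∧ α ≤ 1 ∧ ∃ N, 1 ≤ N ∧ ∀ x y, T.Adj x y → c x = c x₀ →
      (∃ γ ∈ Γ, (γ.1 x, γ.1 y) ∈ D) → α ≤ (step T)^[2 * N] (orbitInd Γ x₀ y₀) x y := by
  set δ := mean m (orbitInd Γ x₀ y₀) x₀ y₀ with hδ
  have hδ0 : 0 < δ := mean_orbitInd_pos hm c hdeg h₀ h₀ rfl
  have hinv := orbitInd_invariant (Γ := Γ) x₀ y₀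
  have hev : ∀ p ∈ D, ∀ᶠ n in atTop, T.Adj p.1 p.2 → c p.1 = c x₀ →
      δ / 2 ≤ (step T)^[2 * n] (orbitInd Γ x₀ y₀) p.1 p.2 := by
    intro p _
    by_cases hp : T.Adj p.1 p.2 ∧ c p.1 = c x₀
    · have h1 := tendsto_iterate_step hm c hdeg hd3 hinv (abs_orbitInd_le x₀ y₀) hp.1
      rw [mean_eq_of_color hm c hdeg hinv hp.1 h₀ hp.2] at h1
      filter_upwards [h1.eventually_const_le (show δ / 2 < δ by linarith)] with n hn _ _ using hn
    · exact Eventually.of_forall fun n h1 h2 => absurd ⟨h1, h2⟩ hp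
  obtain ⟨N, hN, hN1⟩ := (((hD.eventually_all).2 hev).and (eventually_ge_atTop 1)).exists
  refine ⟨min (δ / 2) 1, lt_min (by linarith) one_pos, min_le_right _ _, N, hN1, ?_⟩
  rintro x y hxy hx ⟨γ, hγ, hp⟩
  have := hN _ hp (γ.1.map_rel_iff.2 hxy) ((color_smul c γ x).trans hx)
  rw [hinv.iterate_step (2 * N) γ hγ] at this
  exact (min_le_left _ _).trans this

/-- Exponential convergence of the non-backtracking walk, uniformly over the bounded functions. -/
theorem exists_rate (hG : IsGeometricallyFinite Γ) (hm : InvMeasure m) (c : T.Coloring Bool)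
    (hdeg : ∀ v w, c v = c w → T.degree v = T.degree w) (hd3 : ∀ v, 3 ≤ T.degree v)
    {x₀ y₀ : V} (h₀ : T.Adj x₀ y₀) :
    ∃ ρ : ℝ, 0 < ρ ∧ ρ < 1 ∧ ∀ x y, T.Adj x y → c x = c x₀ → ∃ C : ℝ, 0 ≤ C ∧
      ∀ f : V → V → ℝ, Invariant Γ f → (∀ u w, |f u w| ≤ 1) → ∀ n,
        |(step T)^[n] f x y - mean m ((step T)^[n] f) x y| ≤ C * ρ ^ n := by
  obtain ⟨W, hW, hW0, hdrift, hsub⟩ := exists_drift hG hd3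
  obtain ⟨D, hD, hDW⟩ := hsub 1280
  obtain ⟨α, hα, hα1, N, hN1, hmin⟩ := exists_minorization hm c hdeg hd3 h₀ hD
  set κ : ℝ := 1 - α / 18 with hκ
  have hκ0 : 0 < κ := by rw [hκ]; linarith
  have hκ1 : κ < 1 := by rw [hκ]; linarith
  have hWn : ∀ n x y, T.Adj x y → (step T)^[n] W x y ≤ W x y + 40 := by
    intro n x y hxy
    refine (iterate_step_drift hd3 c hdrift n hxy).trans ?_
    have : (7 / 8 : ℝ) ^ n ≤ 1 := pow_le_one₀ (by norm_num) (by norm_num)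
    have := mul_le_mul_of_nonneg_right this (hW0 x y)
    linarith
  have hWN : ∀ x y, T.Adj x y → (step T)^[2 * N] W x y ≤ 7 / 8 * W x y + 40 := by
    intro x y hxy
    refine (iterate_step_drift hd3 c hdrift _ hxy).trans ?_
    have : (7 / 8 : ℝ) ^ (2 * N) ≤ (7 / 8) ^ 1 :=
      pow_le_pow_of_le_one (by norm_num) (by norm_num) (by omega)
    have := mul_le_mul_of_nonneg_right this (hW0 x y)
    linarith
  have hcenter : ∀ f : V → V → ℝ, Invariant Γ f → (∀ u w, |f u w| ≤ 1) → ∀ j : ℕ, ∃ k,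
      ∀ x y, T.Adj x y → c x = c x₀ →
        |(step T)^[2 * (N * j)] f x y - k| ≤ κ ^ j * (1 + α / 80 * W x y) := by
    intro f hf hf1 j
    induction j with
    | zero =>
      refine ⟨0, fun x y _ _ => ?_⟩
      have := mul_nonneg (show 0 ≤ α / 80 by linarith) (hW0 x y)
      simpa using (hf1 x y).trans (by linarith)
    | succ j ih =>
      obtain ⟨k, hk⟩ := ih
      obtain ⟨k', hk'⟩ := harris_contraction hd3 c hW hW0 h₀ rfl hWN hα hα1
        (fun x y hxy hx hxW => hmin x y hxy hx (hDW x y hxy hxW)) (hf.iterate_step _)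
        (pow_nonneg hκ0.le j) hk
      refine ⟨k', fun x y hxy hx => ?_⟩
      have := hk' x y hxy hx
      rw [← Function.iterate_add_apply] at this
      rw [pow_succ', show 2 * (N * (j + 1)) = 2 * N + 2 * (N * j) by ring]
      exact this
  have hconv : ∀ f : V → V → ℝ, Invariant Γ f → (∀ u w, |f u w| ≤ 1) → ∀ j : ℕ,
      ∀ x y, T.Adj x y → c x = c x₀ → |(step T)^[2 * (N * j)] f x y - mean m f x y| ≤
        2 * (1 + α / 80 * (W x y + 40)) * κ ^ j := by
    intro f hf hf1 j x y hxy hx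
    obtain ⟨k, hk⟩ := hcenter f hf hf1 j
    have hκj : 0 < κ ^ j := pow_pos hκ0 j
    -- Later iterates stay near the same centre `k`; letting `l` tend to infinity then places the
    -- mean near `k` too.
    have hb : ∀ l, |(step T)^[2 * (l + N * j)] f x y - k| ≤
        κ ^ j * (1 + α / 80 * (W x y + 40)) := by
      intro l
      rw [show 2 * (l + N * j) = 2 * l + 2 * (N * j) by ring, Function.iterate_add_apply]
      have h1 := iterate_step_two_mul_mono c (f := (step T)^[2 * (N * j)] f)
        (g := fun u w => (k + κ ^ j) + κ ^ j * (α / 80) * W u w + 0 * W u w) l hxy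
        fun u w huw hu => by linarith [(abs_le.1 (hk u w huw (hu.trans hx))).2]
      have h2 := iterate_step_two_mul_mono c (g := (step T)^[2 * (N * j)] f)
        (f := fun u w => (k - κ ^ j) + (-(κ ^ j * (α / 80))) * W u w + 0 * W u w) l hxy
        fun u w huw hu => by linarith [(abs_le.1 (hk u w huw (hu.trans hx))).1]
      rw [iterate_step_affine hd3] at h1 h2
      have h3 := mul_le_mul_of_nonneg_left (hWn (2 * l) x y hxy)
        (mul_nonneg hκj.le (show 0 ≤ α / 80 by linarith))
      rw [abs_le]
      constructor <;> linarith
    have hlim : Tendsto (fun l => |(step T)^[2 * (l + N * j)] f x y - k|) atTop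
        (𝓝 |mean m f x y - k|) :=
      (((tendsto_add_atTop_iff_nat (N * j)).2
        (tendsto_iterate_step hm c hdeg hd3 hf hf1 hxy)).sub_const k).abs
    have h4 := le_of_tendsto' hlim hb
    have h5 := hb 0
    rw [zero_add] at h5
    rw [abs_le] at h4 h5 ⊢
    constructor <;> linarith
  -- The contraction `κ` is spread over the `2 * N` steps of a block; the division by `κ` pays for
  -- the incomplete last block.
  refine ⟨κ ^ (((2 * N : ℕ) : ℝ)⁻¹), Real.rpow_pos_of_pos hκ0 _,
    Real.rpow_lt_one hκ0.le hκ1 (by positivity), fun x y hxy hx =>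
    ⟨2 * (1 + α / 80 * (W x y + 40)) / κ, ?_, fun f hf hf1 n => ?_⟩⟩
  · have := hW0 x y
    positivity
  set ρ : ℝ := κ ^ (((2 * N : ℕ) : ℝ)⁻¹) with hρ
  have hρ0 : 0 < ρ := Real.rpow_pos_of_pos hκ0 _
  have hρ1 : ρ < 1 := Real.rpow_lt_one hκ0.le hκ1 (by positivity)
  have hρN : ρ ^ (2 * N) = κ := Real.rpow_inv_natCast_pow hκ0.le (by omega)
  set j := n / (2 * N) with hj
  set i := n % (2 * N) with hi
  have hn : n = 2 * (N * j) + i := by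
    rw [hj, hi, ← mul_assoc]; exact (Nat.div_add_mod n (2 * N)).symm
  have hilt : i < 2 * N := Nat.mod_lt _ (by omega)
  have h1 := hconv ((step T)^[i] f) (hf.iterate_step i) (abs_iterate_step_le hf1 i) j x y hxy hx
  have h2 := mean_iterate_step hm c hdeg hd3 (hf.iterate_step i) (abs_iterate_step_le hf1 i)
    (2 * (N * j)) hxy
  rw [if_pos (even_two_mul _), ← Function.iterate_add_apply, ← hn] at h2
  rw [← Function.iterate_add_apply, ← hn] at h1
  rw [h2]
  refine h1.trans ?_
  have hC0 : 0 ≤ 2 * (1 + α / 80 * (W x y + 40)) := by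
    have := hW0 x y
    positivity
  rw [div_mul_eq_mul_div (2 * (1 + α / 80 * (W x y + 40))), le_div_iff₀ hκ0, mul_assoc]
  refine mul_le_mul_of_nonneg_left ?_ hC0
  have h3 : ρ ^ n = κ ^ j * ρ ^ i := by
    rw [hn, pow_add, ← mul_assoc 2 N j, pow_mul, hρN]
  rw [h3]
  refine mul_le_mul_of_nonneg_left ?_ (pow_pos hκ0 j).le
  rw [← hρN]
  exact pow_le_pow_of_le_one hρ0.le hρ1.le hilt.le

end Ergodicity

/-! ### Limit laws, tightness and total variation -/

section Limits

open scoped BigOperators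

/-- The positive and the negative part have as masses the differences on a Hahn set and its
complement, each at most `ε`. -/
theorem tvNorm_le {X : Type*} [MeasurableSpace X] (μ ν : Measure X) [IsFiniteMeasure μ]
    [IsFiniteMeasure ν] {ε : ℝ} (h : ∀ A, |μ.real A - ν.real A| ≤ ε) : tvNorm μ ν ≤ 2 * ε := by
  unfold tvNorm
  set s := μ.toSignedMeasure - ν.toSignedMeasure with hs
  have happ : ∀ A, MeasurableSet A → s A = μ.real A - ν.real A := fun A hA =>
    Measure.toSignedMeasure_sub_apply hA
  obtain ⟨i, hi, h1, h2, hp, hn⟩ := s.toJordanDecomposition_spec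
  have e1 : (s.toJordanDecomposition.posPart).real Set.univ = s i := by
    rw [hp, SignedMeasure.toMeasureOfZeroLE_real_apply _ h1 hi MeasurableSet.univ, Set.inter_univ]
  have e2 : (s.toJordanDecomposition.negPart).real Set.univ = -s iᶜ := by
    rw [hn, SignedMeasure.toMeasureOfLEZero_real_apply _ h2 hi.compl MeasurableSet.univ,
      Set.inter_univ]
  change s.totalVariation.real Set.univ ≤ _
  rw [SignedMeasure.totalVariation, measureReal_add_apply, e1, e2, happ i hi, happ _ hi.compl]
  have h3 := abs_le.1 (h i)
  have h4 := abs_le.1 (h iᶜ)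
  linarith [h3.2, h4.1]

theorem exists_finset_measureReal {X : Type*} [MeasurableSpace X] [Countable X] (μ : Measure X)
    [IsProbabilityMeasure μ] {ε : ℝ} (hε : 0 < ε) : ∃ K : Finset X, 1 - ε < μ.real K := by
  classical
  have : Nonempty X := nonempty_of_isProbabilityMeasure μ
  obtain ⟨e, he⟩ := exists_surjective_nat X
  have hmono : Monotone fun n => (((Finset.range n).image e : Finset X) : Set X) := by
    intro a b hab
    exact Finset.coe_subset.2 (Finset.image_subset_image (Finset.range_mono hab))
  have h1 := tendsto_measure_iUnion_atTop (μ := μ) hmono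
  have h2 : (⋃ n, (((Finset.range n).image e : Finset X) : Set X)) = Set.univ := by
    refine Set.eq_univ_of_forall fun x => ?_
    obtain ⟨n, rfl⟩ := he x
    exact Set.mem_iUnion.2 ⟨n + 1, Finset.mem_coe.2 (Finset.mem_image_of_mem e (by simp))⟩
  rw [h2, measure_univ] at h1
  have h3 := (ENNReal.tendsto_toReal ENNReal.one_ne_top).comp h1
  rw [ENNReal.toReal_one] at h3
  obtain ⟨n, hn⟩ := (h3.eventually_const_lt (show 1 - ε < 1 by linarith)).exists
  exact ⟨_, hn⟩

variable {V : Type*} {T : SimpleGraph V} {hT : T.IsTree} {Γ : Subgroup (treeAut T hT)}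

theorem proj_invariant : Invariant Γ (fun _ z : V => proj Γ z) := fun γ hγ _ _ =>
  proj_eq_iff.2 ⟨γ, hγ, rfl⟩

theorem indicator_invariant (A : Set (VQ Γ)) :
    Invariant Γ (fun _ z : V => A.indicator (1 : VQ Γ → ℝ) (proj Γ z)) := fun γ hγ x w => by
  simp only [proj_invariant γ hγ x w]

theorem abs_indicator_le (A : Set (VQ Γ)) (x : VQ Γ) : |A.indicator (1 : VQ Γ → ℝ) x| ≤ 1 := by
  by_cases h : x ∈ A <;> simp [h]

/-- The law of `π (g⁻¹ z)` for a random coset `gΓ`. -/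
noncomputable def vertexLaw (m : Measure (treeAut T hT ⧸ Γ)) (z : V) : Measure (VQ Γ) :=
  Measure.map (pull Γ (fun _ w => proj Γ w) z z) m

variable {m : Measure (treeAut T hT ⧸ Γ)} [IsProbabilityMeasure m]

instance isProbabilityMeasure_vertexLaw (z : V) : IsProbabilityMeasure (vertexLaw m z) :=
  Measure.isProbabilityMeasure_map (measurable_pull proj_invariant z z).aemeasurable

omit [IsProbabilityMeasure m] in
theorem mean_indicator (A : Set (VQ Γ)) (x z : V) :
    mean m (fun _ w => A.indicator 1 (proj Γ w)) x z = (vertexLaw m z).real A := by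
  have h1 := measurable_pull (Γ := Γ) proj_invariant z z
  have hA : MeasurableSet A := MeasurableSpace.measurableSet_top
  rw [vertexLaw, Measure.real, Measure.map_apply h1 hA, ← Measure.real,
    ← integral_indicator_one (h1 hA)]
  rfl

variable [DecidableEq V] [T.LocallyFinite]

theorem vertexLaw_eq_of_color (hm : InvMeasure m) (c : T.Coloring Bool)
    (hdeg : ∀ v w, c v = c w → T.degree v = T.degree w) (hd3 : ∀ v, 3 ≤ T.degree v) {z z' : V}
    (h : c z = c z') : vertexLaw m z = vertexLaw m z' := by
  obtain ⟨y, -, -, -, -, hy, -⟩ := exists_two_neighbors (x := z) (hd3 z)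
  obtain ⟨y', -, -, -, -, hy', -⟩ := exists_two_neighbors (x := z') (hd3 z')
  obtain ⟨g, rfl, -⟩ := exists_treeAut_dart hT c hdeg hy hy' h
  exact (map_pull_smul hm proj_invariant z z g).symm

/-- On the sphere of radius `n + 1` all vertices have the colour of `z`, and the law of a random
translate depends only on the colour. -/
theorem sphereProj_sub_vertexLaw (hm : InvMeasure m) (c : T.Coloring Bool) (d : Bool → ℕ)
    (hd : ∀ v, T.degree v = d (c v)) (hd3 : ∀ i, 3 ≤ d i) (n : ℕ) {v z : V}
    (hz : c z = c v ↔ Even (n + 1)) (A : Set (VQ Γ)) :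
    (sphereProj Γ v (n + 1)).real A - (vertexLaw m z).real A = 𝔼 a ∈ T.neighborFinset v,
      ((step T)^[n] (fun _ w => A.indicator 1 (proj Γ w)) v a -
        mean m ((step T)^[n] (fun _ w => A.indicator 1 (proj Γ w))) v a) := by
  have hdeg : ∀ v w, c v = c w → T.degree v = T.degree w := fun v w h => by rw [hd, hd, h]
  have hd3' : ∀ v, 3 ≤ T.degree v := fun v => by rw [hd]; exact hd3 _
  have hne : (T.neighborFinset v).Nonempty := by
    rw [← Finset.card_pos, SimpleGraph.card_neighborFinset_eq_degree]
    have := hd3' v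
    omega
  rw [Finset.expect_sub_distrib, sphereProj_real Γ c d hd hd3]
  congr 1
  symm
  rw [← Finset.expect_const hne ((vertexLaw m z).real A)]
  refine Finset.expect_congr rfl fun a ha => ?_
  have hva : T.Adj v a := by simpa using ha
  have hcva := color_eq_not (c := c) hva
  rw [mean_iterate_step hm c hdeg hd3' (indicator_invariant A)
    (fun _ w => abs_indicator_le A _) n hva, mean_indicator, mean_indicator]
  rw [Nat.even_add_one] at hz
  split_ifs with h
  · rw [vertexLaw_eq_of_color hm c hdeg hd3' (z := a) (z' := z)]
    rw [hcva]
    have : ¬ c z = c v := fun h' => (hz.1 h') h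
    revert this
    cases c z <;> cases c v <;> simp
  · rw [vertexLaw_eq_of_color hm c hdeg hd3' (z := v) (z' := z) (hz.2 h).symm]

theorem tendsto_sphereProj_sub (hm : InvMeasure m) (c : T.Coloring Bool) (d : Bool → ℕ)
    (hd : ∀ v, T.degree v = d (c v)) (hd3 : ∀ i, 3 ≤ d i) {v : V} {z : ℕ → V}
    (hz : ∀ n, c (z n) = c v ↔ Even (n + 1)) (A : Set (VQ Γ)) :
    Tendsto (fun n => (sphereProj Γ v (n + 1)).real A - (vertexLaw m (z n)).real A) atTop
      (𝓝 0) := by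
  have hdeg : ∀ v w, c v = c w → T.degree v = T.degree w := fun v w h => by rw [hd, hd, h]
  have hd3' : ∀ v, 3 ≤ T.degree v := fun v => by rw [hd]; exact hd3 _
  simp_rw [fun n => sphereProj_sub_vertexLaw hm c d hd hd3 n (hz n) A,
    Finset.expect_eq_sum_div_card]
  rw [← zero_div ((T.neighborFinset v).card : ℝ)]
  refine Tendsto.div_const ?_ _
  rw [← Finset.sum_const_zero (s := T.neighborFinset v)]
  exact tendsto_finsetSum _ fun a ha => tendsto_sub_mean hm c hdeg hd3' (indicator_invariant A)
    (fun _ w => abs_indicator_le A _) (by simpa using ha)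

theorem exists_sphereProj_rate (hG : IsGeometricallyFinite Γ) (hm : InvMeasure m)
    (c : T.Coloring Bool) (d : Bool → ℕ)
    (hd : ∀ v, T.degree v = d (c v)) (hd3 : ∀ i, 3 ≤ d i) :
    ∃ ρ : ℝ, 0 < ρ ∧ ρ < 1 ∧ ∀ v : V, ∃ C : ℝ, ∀ n z, (c z = c v ↔ Even (n + 1)) → ∀ A,
      |(sphereProj Γ v (n + 1)).real A - (vertexLaw m z).real A| ≤ C * ρ ^ n := by
  have hdeg : ∀ v w, c v = c w → T.degree v = T.degree w := fun v w h => by rw [hd, hd, h]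
  have hd3' : ∀ v, 3 ≤ T.degree v := fun v => by rw [hd]; exact hd3 _
  obtain ⟨o⟩ := hT.connected.nonempty
  obtain ⟨y, -, -, -, -, hy, -⟩ := exists_two_neighbors (x := o) (hd3' o)
  obtain ⟨ρ₁, h1, h1', H1⟩ := exists_rate hG hm c hdeg hd3' hy
  obtain ⟨ρ₂, h2, h2', H2⟩ := exists_rate hG hm c hdeg hd3' hy.symm
  -- The contraction treats one colour of the origin at a time; the slower of the two rates serves
  -- both.
  set ρ := max ρ₁ ρ₂ with hρ
  have key : ∀ x y, T.Adj x y → ∃ C : ℝ, ∀ f : V → V → ℝ, Invariant Γ f → (∀ u w, |f u w| ≤ 1) →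
      ∀ n, |(step T)^[n] f x y - mean m ((step T)^[n] f) x y| ≤ C * ρ ^ n := by
    intro x w hxw
    by_cases hx : c x = c o
    · obtain ⟨C, hC, h⟩ := H1 x w hxw hx
      exact ⟨C, fun f hf hf1 n => (h f hf hf1 n).trans (mul_le_mul_of_nonneg_left
        (pow_le_pow_left₀ h1.le (le_max_left _ _) n) hC)⟩
    · obtain ⟨C, hC, h⟩ := H2 x w hxw (by
        rw [color_eq_not hy]
        revert hx
        cases c x <;> cases c o <;> simp)
      exact ⟨C, fun f hf hf1 n => (h f hf hf1 n).trans (mul_le_mul_of_nonneg_left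
        (pow_le_pow_left₀ h2.le (le_max_right _ _) n) hC)⟩
  refine ⟨ρ, lt_max_of_lt_left h1, max_lt h1' h2', fun v => ?_⟩
  have : ∀ a, ∃ C : ℝ, T.Adj v a → ∀ f : V → V → ℝ, Invariant Γ f → (∀ u w, |f u w| ≤ 1) →
      ∀ n, |(step T)^[n] f v a - mean m ((step T)^[n] f) v a| ≤ C * ρ ^ n := by
    intro a
    by_cases h : T.Adj v a
    · obtain ⟨C, hC⟩ := key v a h
      exact ⟨C, fun _ => hC⟩
    · exact ⟨0, fun h' => absurd h' h⟩
  choose C hC using this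
  refine ⟨𝔼 a ∈ T.neighborFinset v, C a, fun n z hz A => ?_⟩
  rw [sphereProj_sub_vertexLaw hm c d hd hd3 n hz A, Finset.expect_mul]
  refine (Finset.abs_expect_le _ _).trans (Finset.expect_le_expect fun a ha => ?_)
  exact hC a (by simpa using ha) _ (indicator_invariant A) (fun _ w => abs_indicator_le A _) n

theorem sphereProj_eq_one (c : T.Coloring Bool) (d : Bool → ℕ)
    (hd : ∀ v, T.degree v = d (c v)) (hd3 : ∀ i, 3 ≤ d i) {v : V} {n : ℕ} {A : Set (VQ Γ)}
    (hA : ∀ w, T.dist v w = n → proj Γ w ∈ A) : (sphereProj Γ v n).real A = 1 := by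
  have hne : {w | T.dist v w = n}.Nonempty := by
    rcases n with _ | n
    · exact ⟨v, by simp⟩
    · have h1 := (iterate_step_one_finsum hT c d hd hd3 n v).1
      by_contra hc
      rw [Set.not_nonempty_iff_eq_empty] at hc
      rw [hc] at h1
      simp at h1
  let _ : MeasurableSpace V := ⊤
  have hp : Measurable (proj Γ) := fun _ _ => MeasurableSpace.measurableSet_top
  have _ : MeasurableSingletonClass V := ⟨fun _ => MeasurableSpace.measurableSet_top⟩
  rw [sphereProj, Measure.real, Measure.map_apply hp MeasurableSpace.measurableSet_top,
    sphereUniform, ProbabilityTheory.uniformOn_eq_one_of (t := proj Γ ⁻¹' A)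
      (finite_sphere hT n v) hne fun w hw => hA w hw, ENNReal.toReal_one]

/-- Finite sets nearly exhausting the two limits control all large radii; the remaining finitely
many spheres are finite and are added entirely. -/
theorem exists_finset_sphereProj (c : T.Coloring Bool) (d : Bool → ℕ)
    (hd : ∀ v, T.degree v = d (c v)) (hd3 : ∀ i, 3 ≤ d i) {o : V}
    {μ : ZMod 2 → ProbabilityMeasure (VQ Γ)} (hμ : SpheresConverge Γ o 2 μ) (v : V) {ε : ℝ}
    (hε : 0 < ε) :
    ∃ K : Finset (VQ Γ), ∀ n : ℕ, 1 - ε ≤ (sphereProj Γ v n).real (K : Set (VQ Γ)) := by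
  classical
  have := countable_of_locallyFinite hT
  have _ : Countable (VQ Γ) := inferInstanceAs (Countable (Quotient _))
  choose K hK using fun k => exists_finset_measureReal (μ k : Measure (VQ Γ)) hε
  have hev : ∀ j < 2, ∃ N, ∀ n ≥ N, 1 - ε ≤ (sphereProj Γ v (2 * n + j)).real
      (K ((j + T.dist o v % 2 : ℕ) : ZMod 2) : Set (VQ Γ)) := fun j hj =>
    eventually_atTop.1 ((hμ v j hj _).eventually_const_le (hK _))
  obtain ⟨N₀, h₀⟩ := hev 0 (by norm_num)
  obtain ⟨N₁, h₁⟩ := hev 1 (by norm_num)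
  set N := 2 * (N₀ + N₁) with hN
  let B : Finset (VQ Γ) := (Finset.range N).biUnion fun n =>
    ((finite_sphere hT n v).toFinset).image (proj Γ)
  refine ⟨K ((0 + T.dist o v % 2 : ℕ) : ZMod 2) ∪ K ((1 + T.dist o v % 2 : ℕ) : ZMod 2) ∪ B,
    fun n => ?_⟩
  by_cases hn : n < N
  · rw [sphereProj_eq_one c d hd hd3]
    · linarith
    · intro w hw
      refine Finset.mem_coe.2 (Finset.mem_union_right _ ?_)
      exact Finset.mem_biUnion.2 ⟨n, by simpa using hn, Finset.mem_image_of_mem _ (by simpa using hw)⟩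
  · rcases Nat.even_or_odd' n with ⟨l, rfl | rfl⟩
    · refine (h₀ l (by omega)).trans (measureReal_mono ?_)
      exact Finset.coe_subset.2 (Finset.subset_union_left.trans Finset.subset_union_left)
    · refine (h₁ l (by omega)).trans (measureReal_mono ?_)
      exact Finset.coe_subset.2 (Finset.subset_union_right.trans Finset.subset_union_left)

/-- The limiting distributions of the spheres. -/
noncomputable def limitLaw (m : Measure (treeAut T hT ⧸ Γ)) [IsProbabilityMeasure m] (o o' : V)
    (k : ZMod 2) : ProbabilityMeasure (VQ Γ) :=
  ⟨vertexLaw m (if k = 0 then o else o'), inferInstance⟩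

omit [DecidableEq V] [T.LocallyFinite] in
theorem color_base_iff (hT : T.IsTree) (c : T.Coloring Bool) {o o' : V} (h : T.Adj o o') (v : V)
    {j n : ℕ} (hn : Even n ↔ Even j) :
    c (if ((j + T.dist o v % 2 : ℕ) : ZMod 2) = 0 then o else o') = c v ↔ Even n := by
  have h1 : ((j + T.dist o v % 2 : ℕ) : ZMod 2) = 0 ↔ (Even j ↔ c o = c v) := by
    rw [ZMod.natCast_eq_zero_iff_even, ← even_dist_iff_bool hT c, Nat.even_add]
    simp [Nat.even_iff]
  rw [hn]
  split_ifs with h2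
  · exact (h1.1 h2).symm
  · rw [h1] at h2
    rw [color_eq_not h]
    revert h2
    cases c o <;> cases c v <;> simp

theorem spheresConverge_limitLaw (hm : InvMeasure m) (c : T.Coloring Bool) (d : Bool → ℕ)
    (hd : ∀ v, T.degree v = d (c v)) (hd3 : ∀ i, 3 ≤ d i) {o o' : V} (h : T.Adj o o') :
    SpheresConverge Γ o 2 (limitLaw m o o') := by
  intro v j _ A
  refine (tendsto_add_atTop_iff_nat 1).1 ?_
  set z : ℕ → V := fun n =>
    if ((n + 1 + T.dist o v % 2 : ℕ) : ZMod 2) = 0 then o else o' with hz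
  have h1 := tendsto_sphereProj_sub hm c d hd hd3 (v := v) (z := z)
    (fun n => color_base_iff hT c h v (j := n + 1) Iff.rfl) A
  have h2 : Tendsto (fun n : ℕ => 2 * n + 1 + j) atTop atTop :=
    tendsto_atTop_mono (fun n => show n ≤ 2 * n + 1 + j by omega) tendsto_id
  have h3 := (h1.comp h2).add_const
    ((limitLaw m o o' ((j + T.dist o v % 2 : ℕ) : ZMod 2) : Measure (VQ Γ)).real A)
  rw [zero_add] at h3
  refine h3.congr fun n => ?_
  have h4 : z (2 * n + 1 + j) = if ((j + T.dist o v % 2 : ℕ) : ZMod 2) = 0 then o else o' := by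
    have : ((2 * n + 1 + j + 1 + T.dist o v % 2 : ℕ) : ZMod 2) =
        ((j + T.dist o v % 2 : ℕ) : ZMod 2) := by
      rw [show 2 * n + 1 + j + 1 + T.dist o v % 2 = 2 * (n + 1) + (j + T.dist o v % 2) by ring,
        Nat.cast_add, Nat.cast_mul]
      simp [show (2 : ZMod 2) = 0 from rfl]
    simp only [hz, this]
  simp only [Function.comp, h4]
  rw [show 2 * n + 1 + j + 1 = 2 * (n + 1) + j by ring]
  exact sub_add_cancel _ _

theorem tvNorm_isLittleO (hG : IsGeometricallyFinite Γ) (hm : InvMeasure m) (c : T.Coloring Bool)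
    (d : Bool → ℕ) (hd : ∀ v, T.degree v = d (c v)) (hd3 : ∀ i, 3 ≤ d i) {o o' : V}
    (h : T.Adj o o') :
    ∃ r : ℝ, 1 < r ∧ ∀ v : V, ∀ j < 2,
      (fun n : ℕ => tvNorm (sphereProj Γ v (2 * n + j))
        (limitLaw m o o' ((j + T.dist o v % 2 : ℕ) : ZMod 2) : Measure (VQ Γ)))
        =o[atTop] (fun n : ℕ => (r ^ n)⁻¹) := by
  obtain ⟨ρ, hρ0, hρ1, hρ⟩ := exists_sphereProj_rate (m := m) hG hm c d hd hd3
  refine ⟨ρ⁻¹, (one_lt_inv₀ hρ0).2 hρ1, fun v j _ => ?_⟩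
  obtain ⟨C, hC⟩ := hρ v
  have hC0 : 0 ≤ C := by
    have := hC 0 (if ((1 + T.dist o v % 2 : ℕ) : ZMod 2) = 0 then o else o')
      (color_base_iff hT c h v Iff.rfl) ∅
    simpa using this
  -- The radius `2 * n + j` gives decay like `ρ ^ (2 * n)`. One factor `ρ ^ n` is the claimed rate,
  -- the other turns `O` into `o`.
  have hbound : ∀ n, 1 ≤ n → tvNorm (sphereProj Γ v (2 * n + j))
      (limitLaw m o o' ((j + T.dist o v % 2 : ℕ) : ZMod 2) : Measure (VQ Γ)) ≤
        2 * C / ρ * (ρ ^ n * ρ ^ n) := by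
    intro n hn
    obtain ⟨l, rfl⟩ := Nat.exists_eq_add_of_le' hn
    have h1 := tvNorm_le (sphereProj Γ v (2 * l + 1 + j + 1))
      (limitLaw m o o' ((j + T.dist o v % 2 : ℕ) : ZMod 2) : Measure (VQ Γ))
      (hC (2 * l + 1 + j) _ (color_base_iff hT c h v
        (by simp [Nat.even_add, Nat.even_add_one])))
    rw [show 2 * l + 1 + j + 1 = 2 * (l + 1) + j by ring] at h1
    refine h1.trans ?_
    have h2 : ρ ^ (2 * l + 1 + j) ≤ ρ ^ (2 * l + 1) :=
      pow_le_pow_of_le_one hρ0.le hρ1.le (by omega)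
    have h3 : 2 * C / ρ * (ρ ^ (l + 1) * ρ ^ (l + 1)) = 2 * (C * ρ ^ (2 * l + 1)) := by
      field_simp
      ring
    rw [h3]
    linarith [mul_le_mul_of_nonneg_left h2 hC0]
  have hO : (fun n : ℕ => tvNorm (sphereProj Γ v (2 * n + j))
      (limitLaw m o o' ((j + T.dist o v % 2 : ℕ) : ZMod 2) : Measure (VQ Γ))) =O[atTop]
        fun n : ℕ => ρ ^ n * ρ ^ n := by
    refine IsBigO.of_bound (2 * C / ρ) ?_
    filter_upwards [eventually_ge_atTop 1] with n hn
    rw [Real.norm_of_nonneg (show 0 ≤ tvNorm _ _ from ENNReal.toReal_nonneg), Real.norm_of_nonneg (by positivity)]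
    exact hbound n hn
  refine hO.trans_isLittleO ?_
  simp only [inv_pow, inv_inv]
  have h1 : (fun n : ℕ => ρ ^ n) =o[atTop] fun _ : ℕ => (1 : ℝ) :=
    (isLittleO_one_iff ℝ).2 (tendsto_pow_atTop_nhds_zero_of_lt_one hρ0.le hρ1)
  simpa using h1.mul_isBigO (isBigO_refl (fun n : ℕ => ρ ^ n) atTop)

end Limits

end TreeLattice

theorem theoremE {V : Type*} (T : SimpleGraph V) (hT : T.IsTree) (d₁ d₂ : ℕ) (hd₁ : 3 ≤ d₁)
    (hd₂ : 3 ≤ d₂) (hreg : TreeLattice.IsBiregular T d₁ d₂)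
    (Γ : Subgroup (TreeLattice.treeAut T hT)) (hΓ : TreeLattice.IsTreeLattice Γ) (o : V) :
    -- no escape of mass
    (∀ v : V, ∀ ε : ℝ, 0 < ε → ∃ K : Finset (TreeLattice.VQ Γ), ∀ n : ℕ,
      1 - ε ≤ (TreeLattice.sphereProj Γ v n).real (K : Set (TreeLattice.VQ Γ))) ∧
    -- limiting distributions
    (∃ p : ℕ, 0 < p ∧ ∃ μ : ZMod p → ProbabilityMeasure (TreeLattice.VQ Γ),
      TreeLattice.SpheresConverge Γ o p μ) ∧
    -- exponential convergence
    (TreeLattice.IsGeometricallyFinite Γ →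
      ∃ μ : ZMod 2 → ProbabilityMeasure (TreeLattice.VQ Γ),
        TreeLattice.SpheresConverge Γ o 2 μ ∧
        ∃ r : ℝ, 1 < r ∧ ∀ v : V, ∀ j < 2,
          (fun n : ℕ => TreeLattice.tvNorm (TreeLattice.sphereProj Γ v (2 * n + j))
            (μ ((j + T.dist o v % 2 : ℕ) : ZMod 2) : Measure (TreeLattice.VQ Γ)))
            =o[atTop] (fun n : ℕ => (r ^ n)⁻¹)) := by
  classical
  obtain ⟨c, hc⟩ := hreg
  have hfin : ∀ v, (T.neighborSet v).Finite := fun v => by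
    rw [← Set.encard_ne_top_iff, hc v]
    split_ifs <;> simp
  have _ : T.LocallyFinite := fun v => (hfin v).fintype
  have hd : ∀ v, T.degree v = (fun i : Bool => if i = true then d₁ else d₂) (c v) := by
    intro v
    have h := hc v
    rw [← SimpleGraph.coe_neighborFinset, Set.encard_coe_eq_coe_finsetCard,
      SimpleGraph.card_neighborFinset_eq_degree] at h
    simp only
    split_ifs at h ⊢ <;> exact_mod_cast h
  have hd3 : ∀ i : Bool, 3 ≤ (fun i : Bool => if i = true then d₁ else d₂) i := by
    intro i
    simp only
    split_ifs <;> assumption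
  obtain ⟨-, m, hm1, hm⟩ := hΓ
  have _ : IsProbabilityMeasure m := hm1
  obtain ⟨o', -, -, -, -, ho, -⟩ := TreeLattice.exists_two_neighbors (x := o)
    (show 3 ≤ T.degree o by rw [hd]; exact hd3 _)
  have hconv := TreeLattice.spheresConverge_limitLaw (m := m) hm c _ hd hd3 ho
  exact ⟨fun v ε hε => TreeLattice.exists_finset_sphereProj c _ hd hd3 hconv v hε,
    ⟨2, two_pos, _, hconv⟩,
    fun hG => ⟨_, hconv, TreeLattice.tvNorm_isLittleO hG hm c _ hd hd3 ho⟩⟩
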